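/- Let $2\le l$ and $1\le k<n$ be integers. There are $n$ items with scores $\theta_1\ge\dots\ge\theta_k>\theta_{k+1}\ge\dots\ge\theta_n>0$, labelled by $\{1,\dots,n\}$ through a permutation unknown to the learner. An active algorithm is a randomized procedure that is given $n,k,l$ (but neither the scores nor the permutation), repeatedly chooses, depending on all earlier answers, a set $S$ of labels with $2\le |S|\le l$, and is told a winner drawn independently from the multinomial logit (MNL) model: item $a\in S$ is reported with probability $\theta_a/\sum_{j\in S}\theta_j$. At some time it stops and outputs a set of labels. Put $$H=\frac{n}{l}+k+\frac{\sum_{i\ge k+1}\theta_i}{\theta_k}+\sum_{i\ge k+1,\ \theta_i\ge\theta_k/2}\frac{\theta_k^2}{(\theta_k-\theta_i)^2}+\sum_{i\le k,\ \theta_i\le 2\theta_{k+1}}\frac{\theta_{k+1}^2}{(\theta_{k+1}-\theta_i)^2}.$$ There is a universal exponent $p$ such that for every $c\in\mathbb N$ there are a constant $C>0$ and, for all $n,k,l$, an active algorithm with the following property. For all scores and every labelling as above, with probability at least $1-n^{-c}$ the algorithm stops after at most $$C\,\Bigl(\log\frac{n\,\theta_k}{\theta_k-\theta_{k+1}}\Bigr)^{p}\,H$$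 comparisons and outputs exactly the set of labels of the top-$k$ items. (That is, with high probability the algorithm identifies the top-$k$ items with $\tilde O(H)$ comparisons, where $\tilde O$ hides polylogarithmic factors in $n$ and in the inverse relative gap $\theta_k/(\theta_k-\theta_{k+1})$.) -/

import Mathlib

open scoped ENNReal BigOperators

noncomputable section

/-- A comparison set: at least two and at most `l` of the `n` labels. -/
abbrev Query (n l : ℕ) : Type := {S : Finset (Fin n) // 2 ≤ S.card ∧ S.card ≤ l}

theorem Query.nonempty {n l : ℕ} (S : Query n l) : S.1.Nonempty :=
  Finset.card_pos.mp (lt_of_lt_of_le Nat.zero_lt_two S.2.1)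

/-- The multinomial logit choice law: the item `a ∈ S` is reported with probability
`w a / ∑ j ∈ S, w j`. -/
def mnlChoice {n : ℕ} (w : Fin n → ℝ) (hw : ∀ a, 0 < w a) (S : Finset (Fin n))
    (hS : S.Nonempty) : PMF (Fin n) :=
  PMF.ofFinset (fun a => if a ∈ S then ENNReal.ofReal (w a / ∑ j ∈ S, w j) else 0) S
    (by
      have hpos : 0 < ∑ j ∈ S, w j := Finset.sum_pos (fun j _ => hw j) hS
      rw [Finset.sum_congr rfl (fun a ha => if_pos ha),
        ← ENNReal.ofReal_sum_of_nonneg (fun a _ => (div_pos (hw a) hpos).le),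
        ← Finset.sum_div, div_self hpos.ne', ENNReal.ofReal_one])
    (fun a ha => if_neg ha)

/-- A randomized active (adaptive) algorithm on `n` labels with comparison sets of size at most
`l`. Its internal state is drawn from `init`; in a state it either asks for one comparison
(`Sum.inl S`) or halts with an output (`Sum.inr O`); after the reported winner of the comparison it
moves, possibly at random, to a new state. The winners are all it ever learns about the scores. -/
structure ActiveAlgorithm (n l : ℕ) where
  State : Type
  init : PMF State
  act : State → Query n l ⊕ Finset (Fin n)
  update : State → Fin n → PMF State

namespace ActiveAlgorithm

variable {n l : ℕ}

/-- The law of the result of running `A` from state `s` with at most `N` comparisons, when the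
label `a` has score `w a` and the comparisons are answered independently by the multinomial logit
model: `some O` if `A` halts with output `O` after at most `N` comparisons, and `none` if it asks
for more than `N` comparisons. -/
def runFrom (A : ActiveAlgorithm n l) (w : Fin n → ℝ) (hw : ∀ a, 0 < w a) :
    ℕ → A.State → PMF (Option (Finset (Fin n)))
  | 0, s =>
    match A.act s with
    | Sum.inr O => PMF.pure (some O)
    | Sum.inl _ => PMF.pure none
  | N + 1, s =>
    match A.act s with
    | Sum.inr O => PMF.pure (some O)
    | Sum.inl S =>
      (mnlChoice w hw S.1 S.nonempty).bind fun a =>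
        (A.update s a).bind fun s' => runFrom A w hw N s'

/-- The law of the result of a run from the initial state with at most `N` comparisons. -/
def run (A : ActiveAlgorithm n l) (w : Fin n → ℝ) (hw : ∀ a, 0 < w a) (N : ℕ) :
    PMF (Option (Finset (Fin n))) :=
  A.init.bind (A.runFrom w hw N)

end ActiveAlgorithm

/-- An instance: `n` items numbered by rank (item `i + 1` of the usual numbering is `i : Fin n`)
with positive scores in nonincreasing order, a number `1 ≤ k < n` such that the `k`-th score is
strictly larger than the next one, and a labelling: item `i` carries the label `label i`. -/
structure RankingInstance (n k : ℕ) where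
  one_le : 1 ≤ k
  lt : k < n
  θ : Fin n → ℝ
  pos : ∀ i, 0 < θ i
  anti : Antitone θ
  gap : θ ⟨k, lt⟩ < θ ⟨k - 1, (Nat.sub_le k 1).trans_lt lt⟩
  label : Equiv.Perm (Fin n)

namespace RankingInstance

variable {n k : ℕ} (I : RankingInstance n k)

/-- The score `θ_k` of the `k`-th best item. -/
def θk : ℝ := I.θ ⟨k - 1, (Nat.sub_le k 1).trans_lt I.lt⟩

/-- The score `θ_{k+1}` of the best item outside the top `k`. -/
def θk1 : ℝ := I.θ ⟨k, I.lt⟩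

/-- The score of the item that carries the label `a`. -/
def labelScore (a : Fin n) : ℝ := I.θ (I.label.symm a)

theorem labelScore_pos (a : Fin n) : 0 < I.labelScore a := I.pos _

/-- The labels of the top-`k` items. -/
def topLabels : Finset (Fin n) :=
  (Finset.univ.filter fun i : Fin n => (i : ℕ) < k).map I.label.toEmbedding

/-- The instance complexity
`n/l + k + (∑_{i>k} θ_i)/θ_k + ∑_{i>k, θ_i ≥ θ_k/2} θ_k²/(θ_k-θ_i)²
  + ∑_{i≤k, θ_i ≤ 2θ_{k+1}} θ_{k+1}²/(θ_{k+1}-θ_i)²`. -/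
def complexity (l : ℕ) : ℝ :=
  (n : ℝ) / l + k
    + (∑ i ∈ Finset.univ.filter (fun i : Fin n => k ≤ (i : ℕ)), I.θ i) / I.θk
    + ∑ i ∈ Finset.univ.filter (fun i : Fin n => k ≤ (i : ℕ) ∧ I.θk / 2 ≤ I.θ i),
        I.θk ^ 2 / (I.θk - I.θ i) ^ 2
    + ∑ i ∈ Finset.univ.filter (fun i : Fin n => (i : ℕ) < k ∧ I.θ i ≤ 2 * I.θk1),
        I.θk1 ^ 2 / (I.θk1 - I.θ i) ^ 2

end RankingInstance

end

/-! Write u for the score of the best item outside the top k, v for that of the k-th item, and W for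
the sum of the scores outside the top divided by v. The algorithm first finds a small candidate set
containing the top, then refines it by comparing candidates with random pivots.

Counting (only if 8k ≤ n). Random sets of size s = min(l, n/(4k)) are compared. Given that a top
item is in the set, the expected number of other top items there is at most 1/4, so the item wins
with probability at least 1/(2(n/s + W)) (`le_rate`). Higher scores win at higher rates
(`rate_le_rate`), so for i in the top and j outside, 2^(wins of j), killed at the first win of i, is
a supermartingale. Hence, once k labels have about log n wins each, every top item has very likely
won at least once. The labels with a win are the candidates; there are no more of them than
comparisons made (`fail_count`).

Refinement. In each round all candidates are compared with one uniformly random pivot, and those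
clearly above or below enough others are accepted or rejected. Accurate estimates never cause a
wrong decision (`Consistent.next`). At constant accuracy, the number of candidates whose score is
off the threshold by more than a factor two contracts by 3/4 in expectation over the pivot
(`four_mul_sum_card_far_le`), so O(log n) coarse rounds remove them all. Then all scores are
comparable with the pivot's and win probabilities resolve relative gaps: halving the accuracy radius
halves the largest surviving relative gap (`relGap_undecided_le`). A candidate surviving r fine
rounds contributes at least 4^r/9 to the inverse-square sums of the complexity, so the 4^r
comparisons per candidate, up to logarithms, are paid for by these sums (`card_mul_four_pow_le`).

All probability estimates are bounds on the failure probability from a state with a given remaining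
budget, proved by induction on the number of remaining rounds. -/

noncomputable section

/-! ### Expectations under discrete laws -/

namespace PMF

variable {α β : Type*}

/-- The expectation of an extended nonnegative function. -/
def expect (p : PMF α) (f : α → ℝ≥0∞) : ℝ≥0∞ := ∑' a, p a * f a

theorem expect_pure (a : α) (f : α → ℝ≥0∞) : (PMF.pure a).expect f = f a := by
  classical
  unfold expect
  rw [tsum_eq_single a]
  · simp
  · intro b hb; simp [PMF.pure_apply, hb]

theorem expect_bind (p : PMF α) (g : α → PMF β) (f : β → ℝ≥0∞) :
    (p.bind g).expect f = p.expect fun a => (g a).expect f := by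
  unfold expect
  simp_rw [PMF.bind_apply, ← ENNReal.tsum_mul_right, ← ENNReal.tsum_mul_left]
  rw [ENNReal.tsum_comm]
  simp_rw [mul_assoc]

theorem expect_map (p : PMF α) (g : α → β) (f : β → ℝ≥0∞) :
    (p.map g).expect f = p.expect fun a => f (g a) := by
  rw [← PMF.bind_pure_comp, expect_bind]
  simp only [Function.comp, expect_pure]

theorem expect_mono (p : PMF α) {f g : α → ℝ≥0∞} (h : ∀ a, p a ≠ 0 → f a ≤ g a) :
    p.expect f ≤ p.expect g := by
  refine ENNReal.tsum_le_tsum fun a => ?_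
  by_cases ha : p a = 0
  · simp [ha]
  · gcongr; exact h a ha

theorem expect_const (p : PMF α) (c : ℝ≥0∞) : p.expect (fun _ => c) = c := by
  unfold expect
  rw [ENNReal.tsum_mul_right, p.tsum_coe, one_mul]

theorem expect_add (p : PMF α) (f g : α → ℝ≥0∞) :
    p.expect (fun a => f a + g a) = p.expect f + p.expect g := by
  unfold expect
  simp_rw [mul_add]
  exact ENNReal.tsum_add

theorem expect_mul_left (p : PMF α) (c : ℝ≥0∞) (f : α → ℝ≥0∞) :
    p.expect (fun a => c * f a) = c * p.expect f := by
  unfold expect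
  rw [← ENNReal.tsum_mul_left]
  exact tsum_congr fun a => by ring

theorem expect_mul_right (p : PMF α) (c : ℝ≥0∞) (f : α → ℝ≥0∞) :
    p.expect (fun a => f a * c) = p.expect f * c := by
  simp_rw [mul_comm _ c]
  exact expect_mul_left p c f

theorem expect_finset_sum {ι : Type*} (p : PMF α) (s : Finset ι) (f : ι → α → ℝ≥0∞) :
    p.expect (fun a => ∑ i ∈ s, f i a) = ∑ i ∈ s, p.expect (f i) := by
  classical
  induction s using Finset.induction_on with
  | empty => simp [expect]
  | insert i s hi ih => simp_rw [Finset.sum_insert hi, expect_add, ih]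

theorem expect_fintype [Fintype α] (p : PMF α) (f : α → ℝ≥0∞) :
    p.expect f = ∑ a, p a * f a := tsum_fintype _

theorem expect_uniformOfFinset (s : Finset α) (hs : s.Nonempty) (f : α → ℝ≥0∞) :
    (PMF.uniformOfFinset s hs).expect f = (s.card : ℝ≥0∞)⁻¹ * ∑ a ∈ s, f a := by
  classical
  unfold expect
  rw [tsum_eq_sum (s := s), Finset.mul_sum]
  · exact Finset.sum_congr rfl fun a ha => by
      rw [PMF.uniformOfFinset_apply_of_mem hs ha]
  · intro a ha
    rw [PMF.uniformOfFinset_apply_of_notMem hs ha, zero_mul]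

theorem expect_ite_eq [DecidableEq α] (p : PMF α) (a : α) :
    p.expect (fun b => if b = a then 1 else 0) = p a := by
  unfold expect
  rw [tsum_eq_single a] <;> simp +contextual

theorem expect_ite_ne_add_apply [DecidableEq α] (p : PMF α) (a : α) :
    p.expect (fun b => if b = a then 0 else 1) + p a = 1 := by
  rw [← expect_ite_eq p a, ← expect_add]
  refine Eq.trans ?_ (expect_const p 1)
  congr 1
  funext b
  split_ifs <;> simp

theorem apply_eq_one_sub_expect [DecidableEq α] (p : PMF α) (a : α) :
    p a = 1 - p.expect fun b => if b = a then 0 else 1 := by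
  have h := expect_ite_ne_add_apply p a
  rw [add_comm] at h
  exact ENNReal.eq_sub_of_add_eq
    (ne_top_of_le_ne_top ENNReal.one_ne_top (le_add_self.trans h.le)) h

end PMF

/-! ### Algorithms that proceed in rounds of comparisons -/

/-- A randomized algorithm that proceeds in rounds. In each state it either halts or draws a list
of comparisons together with a rule that turns the list of winners into the next state. -/
structure RoundAlgorithm (n l : ℕ) where
  Conf : Type
  start : Conf
  plan : Conf → PMF (List (Query n l) × (List (Fin n) → Conf)) ⊕ Finset (Fin n)

namespace RoundAlgorithm

variable {n l : ℕ} (M : RoundAlgorithm n l)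

/-- Inside a round: the pending comparison, the later ones, and the rest of the rule. -/
abbrev Inner : Type := Finset (Fin n) ⊕ (Query n l × List (Query n l) × (List (Fin n) → M.Conf))

/-- Open a round; a round without comparisons halts. -/
def openRound : List (Query n l) × (List (Fin n) → M.Conf) → M.Inner
  | ([], _) => Sum.inl ∅
  | (q :: qs, g) => Sum.inr (q, qs, g)

def enter (s : M.Conf) : PMF M.Inner :=
  match M.plan s with
  | Sum.inr O => PMF.pure (Sum.inl O)
  | Sum.inl p => p.map M.openRound

def innerAct : M.Inner → Query n l ⊕ Finset (Fin n)
  | Sum.inl O => Sum.inr O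
  | Sum.inr x => Sum.inl x.1

def innerUpdate : M.Inner → Fin n → PMF M.Inner
  | Sum.inl O, _ => PMF.pure (Sum.inl O)
  | Sum.inr (_, [], g), a => M.enter (g [a])
  | Sum.inr (_, q :: qs, g), a => PMF.pure (Sum.inr (q, qs, fun as => g (a :: as)))

/-- The comparison-by-comparison algorithm that executes the rounds. -/
def toActive : ActiveAlgorithm n l where
  State := M.Inner
  init := M.enter M.start
  act := M.innerAct
  update := M.innerUpdate

variable (w : Fin n → ℝ) (hw : ∀ a, 0 < w a)

/-- The law of the winners of a list of comparisons. -/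
def draw : List (Query n l) → PMF (List (Fin n))
  | [] => PMF.pure []
  | q :: qs => (mnlChoice w hw q.1 q.nonempty).bind fun a => (draw qs).map (a :: ·)

/-- The probability that a run does not output `O` within `N` comparisons. -/
def failFrom (O : Finset (Fin n)) (N : ℕ) (x : M.Inner) : ℝ≥0∞ :=
  (M.toActive.runFrom w hw N x).expect fun o => if o = some O then 0 else 1

def fail (O : Finset (Fin n)) (N : ℕ) (s : M.Conf) : ℝ≥0∞ :=
  (M.enter s).expect (M.failFrom w hw O N)

theorem failFrom_le_one (O : Finset (Fin n)) (N : ℕ) (x : M.Inner) :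
    M.failFrom w hw O N x ≤ 1 :=
  (PMF.expect_mono _ fun o _ => by split_ifs <;> simp).trans (PMF.expect_const _ 1).le

theorem fail_le_one (O : Finset (Fin n)) (N : ℕ) (s : M.Conf) : M.fail w hw O N s ≤ 1 :=
  (PMF.expect_mono _ fun x _ => M.failFrom_le_one w hw O N x).trans (PMF.expect_const _ 1).le

theorem run_apply (O : Finset (Fin n)) (N : ℕ) :
    M.toActive.run w hw N (some O) = 1 - M.fail w hw O N M.start := by
  rw [PMF.apply_eq_one_sub_expect, ActiveAlgorithm.run, PMF.expect_bind]
  rfl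

theorem failFrom_halt (O : Finset (Fin n)) (N : ℕ) : M.failFrom w hw O N (Sum.inl O) = 0 := by
  cases N <;> simp [failFrom, ActiveAlgorithm.runFrom, toActive, innerAct, PMF.expect_pure]

theorem failFrom_query (O : Finset (Fin n)) (qs : List (Query n l)) :
    ∀ (q : Query n l) (g : List (Fin n) → M.Conf) (N : ℕ), qs.length + 1 ≤ N →
      M.failFrom w hw O N (Sum.inr (q, qs, g)) =
        (draw w hw (q :: qs)).expect fun as => M.fail w hw O (N - (qs.length + 1)) (g as) := by
  induction qs with
  | nil =>
    intro q g N hN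
    obtain ⟨N, rfl⟩ : ∃ N', N = N' + 1 := ⟨N - 1, by simp at hN; omega⟩
    simp only [failFrom, ActiveAlgorithm.runFrom, toActive, innerAct, innerUpdate, draw,
      PMF.expect_bind, PMF.expect_map, PMF.expect_pure, fail, List.length_nil, zero_add,
      Nat.add_sub_cancel]
    rfl
  | cons q' qs ih =>
    intro q g N hN
    obtain ⟨N, rfl⟩ : ∃ N', N = N' + 1 := ⟨N - 1, by simp at hN; omega⟩
    have hN' : qs.length + 1 ≤ N := by simpa using hN
    have key := fun a => ih q' (fun as => g (a :: as)) N hN'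
    have e : N + 1 - ((q' :: qs).length + 1) = N - (qs.length + 1) := by simp
    rw [e, draw, PMF.expect_bind]
    simp only [PMF.expect_map]
    simp only [← key]
    simp only [failFrom, ActiveAlgorithm.runFrom, toActive, innerAct, innerUpdate,
      PMF.expect_bind, PMF.expect_pure]

theorem fail_halt {O : Finset (Fin n)} {N : ℕ} {s : M.Conf} (h : M.plan s = Sum.inr O) :
    M.fail w hw O N s = 0 := by
  rw [fail, enter, h]
  simp only [PMF.expect_pure, failFrom_halt]

/-- This is the only recursion used later. Empty rounds are excluded because `openRound` halts on
them, and the round has to fit into the budget so that the run is not cut off inside it. -/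
theorem fail_step {O : Finset (Fin n)} {N : ℕ} {s : M.Conf}
    {p : PMF (List (Query n l) × (List (Fin n) → M.Conf))} (h : M.plan s = Sum.inl p)
    (hlen : ∀ x, p x ≠ 0 → x.1 ≠ [] ∧ x.1.length ≤ N) :
    M.fail w hw O N s = p.expect fun x =>
      (draw w hw x.1).expect fun as => M.fail w hw O (N - x.1.length) (x.2 as) := by
  rw [fail, enter, h]
  simp only [PMF.expect_map]
  have hx : ∀ x, p x ≠ 0 → M.failFrom w hw O N (M.openRound x) =
      (draw w hw x.1).expect fun as => M.fail w hw O (N - x.1.length) (x.2 as) := by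
    rintro ⟨qs, g⟩ hp
    obtain ⟨h1, h2⟩ := hlen _ hp
    cases qs with
    | nil => exact absurd rfl h1
    | cons q qs => exact M.failFrom_query w hw O qs q g N h2
  exact le_antisymm (PMF.expect_mono _ fun x hp => (hx x hp).le)
    (PMF.expect_mono _ fun x hp => (hx x hp).ge)

end RoundAlgorithm
end
-- Concentration of the estimates obtained from a pivot
noncomputable section

variable {n l : ℕ}

theorem expect_mnlChoice (w : Fin n → ℝ) (hw : ∀ a, 0 < w a) (S : Finset (Fin n))
    (hS : S.Nonempty) (f : Fin n → ℝ) (hf : ∀ a, 0 ≤ f a) :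
    (mnlChoice w hw S hS).expect (fun a => ENNReal.ofReal (f a)) =
      ENNReal.ofReal (∑ a ∈ S, w a / (∑ j ∈ S, w j) * f a) := by
  have hpos : 0 < ∑ j ∈ S, w j := Finset.sum_pos (fun j _ => hw j) hS
  rw [PMF.expect_fintype, ENNReal.ofReal_sum_of_nonneg
    (fun a _ => mul_nonneg (div_pos (hw a) hpos).le (hf a)), ← Finset.sum_subset S.subset_univ]
  · refine Finset.sum_congr rfl fun a ha => ?_
    rw [mnlChoice, PMF.ofFinset_apply, if_pos ha, ENNReal.ofReal_mul (div_pos (hw a) hpos).le]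
  · intro a _ ha
    rw [mnlChoice, PMF.ofFinset_apply, if_neg ha, zero_mul]

/-- The probability that `i` beats `j` in a comparison of the two. -/
def winProb (w : Fin n → ℝ) (i j : Fin n) : ℝ := w i / (w i + w j)

namespace RoundAlgorithm

variable (w : Fin n → ℝ) (hw : ∀ a, 0 < w a)

/-- Independence of the answers in a round, in the form needed for exponential moments. -/
theorem expect_draw_prod (g : Fin n → ℝ≥0∞) (qs : List (Query n l)) :
    (draw w hw qs).expect (fun as => (as.map g).prod) =
      (qs.map fun q => (mnlChoice w hw q.1 q.nonempty).expect g).prod := by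
  induction qs with
  | nil => simp [draw, PMF.expect_pure]
  | cons q qs ih =>
    simp only [draw, PMF.expect_bind, PMF.expect_map, List.map_cons, List.prod_cons,
      PMF.expect_mul_left, PMF.expect_mul_right, ih]

/-- Every label of `A` other than `j` is compared with `j` exactly `m` times. -/
def pairQueries (l : ℕ) (A : Finset (Fin n)) (j : Fin n) (m : ℕ) : List (Query n l) :=
  A.toList.flatMap fun i =>
    if h : i ≠ j ∧ 2 ≤ l then
      List.replicate m ⟨{i, j}, by rw [Finset.card_pair h.1]; exact ⟨le_rfl, h.2⟩⟩
    else []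

theorem length_pairQueries_le (A : Finset (Fin n)) (j : Fin n) (m : ℕ) :
    (pairQueries l A j m).length ≤ A.card * m := by
  rw [pairQueries, List.length_flatMap, Finset.sum_map_toList, ← smul_eq_mul]
  refine Finset.sum_le_card_nsmul _ _ _ fun i _ => ?_
  split_ifs <;> simp

theorem pairQueries_ne_nil (hl : 2 ≤ l) {A : Finset (Fin n)} (hA : 1 < A.card) (j : Fin n)
    {m : ℕ} (hm : m ≠ 0) : pairQueries l A j m ≠ [] := by
  obtain ⟨i, hi, hij⟩ := Finset.exists_mem_ne hA j
  rw [pairQueries, Ne, List.flatMap_eq_nil_iff]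
  intro h
  have := h i (Finset.mem_toList.2 hi)
  rw [dif_pos ⟨hij, hl⟩] at this
  simp [hm] at this

/-- The moment generating function of a Bernoulli variable, from |exp t − 1 − t| ≤ t². -/
theorem one_add_mul_exp_le {p t : ℝ} (hp : 0 ≤ p) (hp1 : p ≤ 1) (ht : |t| ≤ 1) :
    1 + p * (Real.exp t - 1) ≤ Real.exp (p * t + t ^ 2) := by
  have h1 := (abs_le.1 (Real.abs_exp_sub_one_sub_id_le ht)).2
  have h2 := Real.add_one_le_exp (p * t + t ^ 2)
  nlinarith [sq_nonneg t]

/-- Only the m comparisons of i with the pivot can report i; all other factors of the product are 1.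
-/
theorem expect_draw_exp_count (hl : 2 ≤ l) {A : Finset (Fin n)} {i j : Fin n} (hi : i ∈ A)
    (hij : i ≠ j) (m : ℕ) {t : ℝ} (ht : |t| ≤ 1) :
    (draw w hw (pairQueries l A j m)).expect
        (fun as => ENNReal.ofReal (Real.exp (t * as.count i))) ≤
      ENNReal.ofReal (Real.exp (m * (winProb w i j * t + t ^ 2))) := by
  classical
  set g : Fin n → ℝ≥0∞ := fun a => ENNReal.ofReal (if a = i then Real.exp t else 1) with hg
  have h1 : ∀ as : List (Fin n),
      ENNReal.ofReal (Real.exp (t * as.count i)) = (as.map g).prod := by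
    intro as
    induction as with
    | nil => simp
    | cons a as ih =>
      rw [List.map_cons, List.prod_cons, ← ih, hg]
      dsimp only
      by_cases h : a = i
      · subst h
        rw [if_pos rfl, List.count_cons_self, ← ENNReal.ofReal_mul (Real.exp_pos _).le,
          ← Real.exp_add]
        push_cast
        ring_nf
      · rw [if_neg h, List.count_cons_of_ne h]
        simp
  simp_rw [h1]
  rw [expect_draw_prod, pairQueries, List.map_flatMap, List.flatMap_def, List.prod_flatten, List.map_map,
    Finset.prod_map_toList, Finset.prod_eq_single i]
  all_goals simp only [Function.comp_apply]
  · rw [dif_pos ⟨hij, hl⟩, List.map_replicate, List.prod_replicate, hg,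
      expect_mnlChoice w hw _ _ _ (fun a => by split_ifs <;> positivity),
      Finset.sum_pair hij, Finset.sum_pair hij, if_pos rfl, if_neg hij.symm, Real.exp_nat_mul,
      ENNReal.ofReal_pow (Real.exp_pos _).le]
    gcongr
    have hi0 := hw i
    have hj0 := hw j
    refine le_trans (le_of_eq ?_) (one_add_mul_exp_le (p := winProb w i j) ?_ ?_ ht)
    · unfold winProb; field_simp; ring
    · unfold winProb; positivity
    · unfold winProb; rw [div_le_one (by positivity)]; linarith
  · intro b _ hb
    split_ifs with h
    · rw [List.map_replicate, List.prod_replicate, hg,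
        expect_mnlChoice w hw _ _ _ (fun a => by split_ifs <;> positivity),
        Finset.sum_pair h.1, Finset.sum_pair h.1, if_neg hb, if_neg hij.symm]
      have hb0 := hw b
      have hj0 := hw j
      rw [show w b / (w b + w j) * 1 + w j / (w b + w j) * 1 = 1 by field_simp]
      simp
    · simp
  · intro h; exact absurd hi h

/-- The estimate of `winProb w i j` from the winners of `pairQueries l A j m`. -/
def estimate (j : Fin n) (m : ℕ) (as : List (Fin n)) (i : Fin n) : ℝ :=
  -- The pivot is never compared with itself; 1/2 is the exact value of `winProb w j j`.
  if i = j then 1 / 2 else as.count i / m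

-- Chernoff bound on both sides with t = ±ε/2: the exponent is m(ε²/4 − ε²/2) = −mε²/4.
open Classical in
theorem expect_draw_inaccurate_one (hl : 2 ≤ l) {A : Finset (Fin n)} {i j : Fin n} (hi : i ∈ A)
    {m : ℕ} (hm : m ≠ 0) {ε : ℝ} (hε : 0 < ε) (hε1 : ε ≤ 1) :
    (draw w hw (pairQueries l A j m)).expect
        (fun as => if |estimate j m as i - winProb w i j| ≤ ε then 0 else 1) ≤
      2 * ENNReal.ofReal (Real.exp (-(m * ε ^ 2 / 4))) := by
  by_cases hij : i = j
  · subst hij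
    have h0 : (1 : ℝ) / 2 - winProb w i i = 0 := by
      have := hw i
      unfold winProb; field_simp; ring
    have : ∀ as : List (Fin n), |estimate i m as i - winProb w i i| ≤ ε := by
      intro as
      rw [estimate, if_pos rfl, h0, abs_zero]; exact hε.le
    simp [this, PMF.expect_const]
  set p := winProb w i j with hp
  have hm0 : (0 : ℝ) < m := by positivity
  have up := expect_draw_exp_count w hw hl hi hij m (t := ε / 2) (by
    rw [abs_of_pos (by positivity)]; linarith)
  have lo := expect_draw_exp_count w hw hl hi hij m (t := -(ε / 2)) (by
    rw [abs_neg, abs_of_pos (by positivity)]; linarith)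
  calc _ ≤ (draw w hw (pairQueries l A j m)).expect (fun as =>
        ENNReal.ofReal (Real.exp (-(ε / 2 * (p + ε) * m))) *
          ENNReal.ofReal (Real.exp (ε / 2 * as.count i)) +
        ENNReal.ofReal (Real.exp (ε / 2 * (p - ε) * m)) *
          ENNReal.ofReal (Real.exp (-(ε / 2) * as.count i))) := by
        refine PMF.expect_mono _ fun as _ => ?_
        split_ifs with h
        · exact zero_le
        rw [not_le, estimate, if_neg hij, lt_abs] at h
        rw [← ENNReal.ofReal_mul (Real.exp_pos _).le, ← ENNReal.ofReal_mul (Real.exp_pos _).le,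
          ← Real.exp_add, ← Real.exp_add]
        rcases h with h | h
        · refine le_trans ?_ le_self_add
          rw [ENNReal.one_le_ofReal, Real.one_le_exp_iff]
          have : (p + ε) * m < as.count i := by
            rw [← lt_div_iff₀ hm0]; linarith
          nlinarith
        · refine le_trans ?_ le_add_self
          rw [ENNReal.one_le_ofReal, Real.one_le_exp_iff]
          have : (as.count i : ℝ) < (p - ε) * m := by
            rw [← div_lt_iff₀ hm0]; linarith
          nlinarith
    _ ≤ _ := by
        rw [PMF.expect_add, PMF.expect_mul_left, PMF.expect_mul_left, two_mul]
        refine add_le_add ((mul_le_mul_right up _).trans ?_) ((mul_le_mul_right lo _).trans ?_)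
        all_goals
          rw [← ENNReal.ofReal_mul (Real.exp_pos _).le, ← Real.exp_add]
          refine ENNReal.ofReal_le_ofReal (Real.exp_le_exp.2 (le_of_eq ?_))
          ring

open Classical in
theorem expect_draw_inaccurate (hl : 2 ≤ l) (A : Finset (Fin n)) (j : Fin n)
    {m : ℕ} (hm : m ≠ 0) {ε : ℝ} (hε : 0 < ε) (hε1 : ε ≤ 1) :
    (draw w hw (pairQueries l A j m)).expect
        (fun as => if ∀ i ∈ A, |estimate j m as i - winProb w i j| ≤ ε then 0 else 1) ≤
      A.card * (2 * ENNReal.ofReal (Real.exp (-(m * ε ^ 2 / 4)))) := by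
  calc _ ≤ (draw w hw (pairQueries l A j m)).expect (fun as => ∑ i ∈ A,
        if |estimate j m as i - winProb w i j| ≤ ε then 0 else 1) := by
        refine PMF.expect_mono _ fun as _ => ?_
        split_ifs with h
        · exact zero_le
        push Not at h
        obtain ⟨i, hi, h⟩ := h
        refine le_trans ?_ (Finset.single_le_sum (fun _ _ => zero_le) hi)
        rw [if_neg h.not_ge]
    _ ≤ _ := by
        rw [PMF.expect_finset_sum, ← nsmul_eq_mul]
        exact Finset.sum_le_card_nsmul _ _ _ fun i hi =>
          expect_draw_inaccurate_one w hw hl hi hm hε hε1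

end RoundAlgorithm
end
-- Accepting and rejecting candidates
noncomputable section

variable {n : ℕ}

theorem winProb_sub {w : Fin n → ℝ} (hw : ∀ a, 0 < w a) (x i j : Fin n) :
    winProb w x j - winProb w i j = w j / (w x + w j) * ((w x - w i) / (w i + w j)) := by
  have := hw x; have := hw i; have := hw j
  unfold winProb
  field_simp
  ring

theorem winProb_lt {w : Fin n → ℝ} (hw : ∀ a, 0 < w a) {x i : Fin n} (j : Fin n)
    (h : winProb w i j < winProb w x j) : w i < w x := by
  have hx := hw x; have hi := hw i; have hj := hw j
  by_contra! hle
  have := winProb_sub hw i x j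
  have : 0 ≤ w j / (w i + w j) * ((w i - w x) / (w x + w j)) :=
    mul_nonneg (by positivity) (div_nonneg (by linarith) (by positivity))
  linarith

namespace TopK

open Classical in
/-- The candidates whose estimate is clearly above that of all but `r` candidates. -/
def accepted (A : Finset (Fin n)) (r : ℕ) (ε : ℝ) (e : Fin n → ℝ) : Finset (Fin n) :=
  A.filter fun i => A.card ≤ (A.filter fun x => e x + 2 * ε < e i).card + r

open Classical in
/-- The candidates whose estimate is clearly below that of at least `r` candidates. -/
def rejected (A : Finset (Fin n)) (r : ℕ) (ε : ℝ) (e : Fin n → ℝ) : Finset (Fin n) :=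
  A.filter fun i => r ≤ (A.filter fun x => e i + 2 * ε < e x).card

def undecided (A : Finset (Fin n)) (r : ℕ) (ε : ℝ) (e : Fin n → ℝ) : Finset (Fin n) :=
  A \ (accepted A r ε e ∪ rejected A r ε e)

/-- All items of `top` are already accepted or still candidates, and nothing else is accepted. -/
structure Consistent (top A Acc : Finset (Fin n)) : Prop where
  union : Acc ∪ A ∩ top = top
  disj : Disjoint Acc A

theorem Consistent.card {top A Acc : Finset (Fin n)} (h : Consistent top A Acc) :
    Acc.card + (A ∩ top).card = top.card := by
  conv_rhs => rw [← h.union]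
  exact (Finset.card_union_of_disjoint (h.disj.mono_right Finset.inter_subset_left)).symm

section Round

variable {w : Fin n → ℝ} {top A Acc : Finset (Fin n)} {ε : ℝ} {e : Fin n → ℝ}
  {j : Fin n}

theorem winProb_lt_of_estimate (hacc : ∀ i ∈ A, |e i - winProb w i j| ≤ ε) {x i : Fin n}
    (hx : x ∈ A) (hi : i ∈ A) (h : e i + 2 * ε < e x) : winProb w i j < winProb w x j := by
  have h1 := abs_le.1 (hacc x hx)
  have h2 := abs_le.1 (hacc i hi)
  linarith

/-- Under accurate estimates a margin of 2ε proves a strict order of the scores. A candidate outside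
the top therefore clearly beats only other candidates outside the top, one fewer than acceptance
requires. -/
theorem accepted_subset (hw : ∀ a, 0 < w a) (hsep : ∀ a ∈ top, ∀ b ∉ top, w b < w a)
    (hacc : ∀ i ∈ A, |e i - winProb w i j| ≤ ε) :
    accepted A (A ∩ top).card ε e ⊆ top := by
  classical
  intro i hi
  obtain ⟨hiA, hcard⟩ := Finset.mem_filter.1 hi
  by_contra hit
  have hsub : A.filter (fun x => e x + 2 * ε < e i) ⊆ (A \ top).erase i := by
    intro x hx
    obtain ⟨hxA, hlt⟩ := Finset.mem_filter.1 hx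
    have hwx := winProb_lt hw j (winProb_lt_of_estimate hacc hiA hxA hlt)
    refine Finset.mem_erase.2 ⟨fun h => by rw [h] at hwx; exact lt_irrefl _ hwx,
      Finset.mem_sdiff.2 ⟨hxA, fun hxt => ?_⟩⟩
    exact lt_asymm hwx (hsep x hxt i hit)
  have h1 := Finset.card_le_card hsub
  have hi' : i ∈ A \ top := Finset.mem_sdiff.2 ⟨hiA, hit⟩
  have h2 := Finset.card_erase_add_one hi'
  have h3 := Finset.card_sdiff_add_card_inter A top
  convert_to A.card ≤ (A.filter (fun x => e x + 2 * ε < e i)).card + (A ∩ top).card at hcard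
  omega

theorem disjoint_rejected (hw : ∀ a, 0 < w a) (hsep : ∀ a ∈ top, ∀ b ∉ top, w b < w a)
    (hacc : ∀ i ∈ A, |e i - winProb w i j| ≤ ε) :
    Disjoint (rejected A (A ∩ top).card ε e) top := by
  classical
  refine Finset.disjoint_left.2 fun i hi hit => ?_
  obtain ⟨hiA, hcard⟩ := Finset.mem_filter.1 hi
  have hsub : A.filter (fun x => e i + 2 * ε < e x) ⊆ (A ∩ top).erase i := by
    intro x hx
    obtain ⟨hxA, hlt⟩ := Finset.mem_filter.1 hx
    have hwx := winProb_lt hw j (winProb_lt_of_estimate hacc hxA hiA hlt)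
    refine Finset.mem_erase.2 ⟨fun h => by rw [h] at hwx; exact lt_irrefl _ hwx,
      Finset.mem_inter.2 ⟨hxA, ?_⟩⟩
    by_contra hxt
    exact lt_asymm hwx (hsep i hit x hxt)
  have h1 := Finset.card_le_card hsub
  have hi' : i ∈ A ∩ top := Finset.mem_inter.2 ⟨hiA, hit⟩
  have h2 := Finset.card_erase_add_one hi'
  convert_to (A ∩ top).card ≤ (A.filter (fun x => e i + 2 * ε < e x)).card at hcard
  omega

theorem Consistent.next (h : Consistent top A Acc) (hw : ∀ a, 0 < w a)
    (hsep : ∀ a ∈ top, ∀ b ∉ top, w b < w a) (hacc : ∀ i ∈ A, |e i - winProb w i j| ≤ ε) :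
    Consistent top (undecided A (A ∩ top).card ε e)
      (Acc ∪ accepted A (A ∩ top).card ε e) := by
  have h1 := accepted_subset hw hsep hacc
  have h2 := Finset.disjoint_left.1 (disjoint_rejected hw hsep hacc)
  have h3 : accepted A (A ∩ top).card ε e ⊆ A := Finset.filter_subset _ _
  have h4 := h.union
  have h5 := Finset.disjoint_left.1 h.disj
  refine ⟨?_, Finset.disjoint_left.2 ?_⟩
  · ext x
    have h4x := Finset.ext_iff.1 h4 x
    have h1x := @h1 x
    have h2x := @h2 x
    have h3x := @h3 x
    simp only [undecided, Finset.mem_union, Finset.mem_inter, Finset.mem_sdiff] at *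
    tauto
  · intro x
    have h5x := @h5 x
    simp only [undecided, Finset.mem_union, Finset.mem_sdiff]
    tauto

/-- A candidate leading every non-top candidate by more than 4ε (the margin 2ε plus two errors ε)
would have been accepted. -/
theorem exists_of_undecided_top (hacc : ∀ i ∈ A, |e i - winProb w i j| ≤ ε) {i : Fin n}
    (hi : i ∈ undecided A (A ∩ top).card ε e) :
    ∃ x ∈ A, x ∉ top ∧ winProb w i j - winProb w x j ≤ 4 * ε := by
  classical
  obtain ⟨hiA, hi⟩ := Finset.mem_sdiff.1 hi
  by_contra! hcon
  refine hi (Finset.mem_union_left _ (Finset.mem_filter.2 ⟨hiA, ?_⟩))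
  have hsub : A \ top ⊆ A.filter (fun x => e x + 2 * ε < e i) := by
    intro x hx
    obtain ⟨hxA, hxt⟩ := Finset.mem_sdiff.1 hx
    have h1 := abs_le.1 (hacc x hxA)
    have h2 := abs_le.1 (hacc i hiA)
    have h3 := hcon x hxA hxt
    exact Finset.mem_filter.2 ⟨hxA, by linarith⟩
  have h1 := Finset.card_le_card hsub
  have h3 := Finset.card_sdiff_add_card_inter A top
  convert_to A.card ≤ (A.filter (fun x => e x + 2 * ε < e i)).card + (A ∩ top).card
  omega

theorem exists_of_undecided_bot (hacc : ∀ i ∈ A, |e i - winProb w i j| ≤ ε) {i : Fin n}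
    (hi : i ∈ undecided A (A ∩ top).card ε e) :
    ∃ x ∈ A, x ∈ top ∧ winProb w x j - winProb w i j ≤ 4 * ε := by
  classical
  obtain ⟨hiA, hi⟩ := Finset.mem_sdiff.1 hi
  by_contra! hcon
  refine hi (Finset.mem_union_right _ (Finset.mem_filter.2 ⟨hiA, ?_⟩))
  have hsub : A ∩ top ⊆ A.filter (fun x => e i + 2 * ε < e x) := by
    intro x hx
    obtain ⟨hxA, hxt⟩ := Finset.mem_inter.1 hx
    have h1 := abs_le.1 (hacc x hxA)
    have h2 := abs_le.1 (hacc i hiA)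
    have h3 := hcon x hxA hxt
    exact Finset.mem_filter.2 ⟨hxA, by linarith⟩
  have h1 := Finset.card_le_card hsub
  convert_to (A ∩ top).card ≤ (A.filter (fun x => e i + 2 * ε < e x)).card
  omega

end Round

/-! ### Contraction of the far candidates and of the relative gaps -/

section Far

open Classical in
/-- The items of `A` whose score is far from the threshold between `u` and `v`. -/
def far (w : Fin n → ℝ) (top : Finset (Fin n)) (u v : ℝ) (A : Finset (Fin n)) :
    Finset (Fin n) :=
  A.filter fun i => (i ∈ top ∧ 2 * u < w i) ∨ (i ∉ top ∧ w i < v / 2)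

/-- The relative distance of a score to the threshold between `u` and `v`. -/
def relGap (w : Fin n → ℝ) (top : Finset (Fin n)) (u v : ℝ) (i : Fin n) : ℝ :=
  if i ∈ top then (w i - u) / u else (v - w i) / v

/-- Double counting: for each b, the elements below b and those above b are disjoint, and both
counts have the same total. -/
theorem two_mul_sum_card_filter_le {α : Type*} (s : Finset α) (r : α → α → Prop)
    [DecidableRel r] (hr : ∀ a b, r a b → ¬ r b a) :
    2 * ∑ b ∈ s, (s.filter fun a => r a b).card ≤ s.card ^ 2 := by
  classical
  have h1 : ∑ b ∈ s, (s.filter fun a => r a b).card = ∑ b ∈ s, (s.filter fun a => r b a).card :=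
    Finset.sum_card_bipartiteAbove_eq_sum_card_bipartiteBelow (fun b a => r a b) (s := s) (t := s)
  rw [two_mul]
  nth_rw 2 [h1]
  rw [← Finset.sum_add_distrib, sq, ← smul_eq_mul]
  refine Finset.sum_le_card_nsmul _ _ _ fun b _ => ?_
  rw [← Finset.card_union_of_disjoint]
  · exact Finset.card_le_card
      (Finset.union_subset (Finset.filter_subset _ _) (Finset.filter_subset _ _))
  · exact Finset.disjoint_filter.2 fun a _ h => hr a b h

/-- The combinatorial core of the contraction, with G j the far survivors for the pivot j. A far
pivot removes the far candidates on its own side that are at least as extreme as itself, on average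
about half of that side. -/
theorem four_mul_sum_card_le (w : Fin n → ℝ) (top A F : Finset (Fin n)) (hF : F ⊆ A)
    (G : Fin n → Finset (Fin n)) (hG : ∀ j ∈ A, G j ⊆ F) (hG0 : ∀ j ∈ A, j ∉ F → G j = ∅)
    (htop : ∀ j ∈ F, j ∈ top → ∀ i ∈ G j, i ∈ top → w i < w j)
    (hbot : ∀ j ∈ F, j ∉ top → ∀ i ∈ G j, i ∉ top → w j < w i) :
    4 * ∑ j ∈ A, (G j).card ≤ 3 * (F.card * A.card) := by
  classical
  set F1 := F.filter (· ∈ top)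
  set F2 := F.filter (· ∉ top)
  have hc : F1.card + F2.card = F.card := Finset.card_filter_add_card_filter_not _
  have e : ∑ j ∈ A, (G j).card = ∑ j ∈ F1, (G j).card + ∑ j ∈ F2, (G j).card := by
    rw [Finset.sum_filter_add_sum_filter_not]
    exact (Finset.sum_subset hF fun j hj hjF => by rw [hG0 j hj hjF, Finset.card_empty]).symm
  have b1 : ∑ j ∈ F1, (G j).card ≤
      ∑ j ∈ F1, (F1.filter fun i => w i < w j).card + F1.card * F2.card := by
    rw [← smul_eq_mul, ← Finset.sum_const, ← Finset.sum_add_distrib]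
    refine Finset.sum_le_sum fun j hj => ?_
    obtain ⟨hjF, hjt⟩ := Finset.mem_filter.1 hj
    refine (Finset.card_le_card ?_).trans (Finset.card_union_le _ _)
    intro i hi
    have hiF := hG j (hF hjF) hi
    by_cases hit : i ∈ top
    · exact Finset.mem_union_left _ (Finset.mem_filter.2
        ⟨Finset.mem_filter.2 ⟨hiF, hit⟩, htop j hjF hjt i hi hit⟩)
    · exact Finset.mem_union_right _ (Finset.mem_filter.2 ⟨hiF, hit⟩)
  have b2 : ∑ j ∈ F2, (G j).card ≤
      ∑ j ∈ F2, (F2.filter fun i => w j < w i).card + F2.card * F1.card := by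
    rw [← smul_eq_mul, ← Finset.sum_const, ← Finset.sum_add_distrib]
    refine Finset.sum_le_sum fun j hj => ?_
    obtain ⟨hjF, hjt⟩ := Finset.mem_filter.1 hj
    refine (Finset.card_le_card ?_).trans (Finset.card_union_le _ _)
    intro i hi
    have hiF := hG j (hF hjF) hi
    by_cases hit : i ∈ top
    · exact Finset.mem_union_right _ (Finset.mem_filter.2 ⟨hiF, hit⟩)
    · exact Finset.mem_union_left _ (Finset.mem_filter.2
        ⟨Finset.mem_filter.2 ⟨hiF, hit⟩, hbot j hjF hjt i hi hit⟩)
  have c1 := two_mul_sum_card_filter_le F1 (fun i j => w i < w j) fun _ _ h => lt_asymm h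
  have c2 := two_mul_sum_card_filter_le F2 (fun i j => w j < w i) fun _ _ h => lt_asymm h
  have hA := Nat.mul_le_mul_left F.card (Finset.card_le_card hF)
  rw [← hc] at hA ⊢
  rw [e]
  zify at *
  -- With f₁, f₂ the sizes of the two sides and f their sum, the total is at most (f₁² + f₂²)/2 +
  -- 2f₁f₂ = f²/2 + f₁f₂ ≤ 3f²/4.
  nlinarith [sq_nonneg ((F1.card : ℤ) - F2.card)]

variable {w : Fin n → ℝ} {top A : Finset (Fin n)} {u v ε : ℝ} {e : Fin n → ℝ} {j : Fin n}

/-- In the product formula `winProb_sub` the factors are at least 1/3, since w x ≤ 2 w j, and 1/4,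
since w i + w j ≤ 2 w i ≤ 4 (w i − w x). -/
theorem top_gap_of_far (hw : ∀ a, 0 < w a) (hu : ∀ a ∉ top, w a ≤ u) (huv : u < v)
    (hv : ∀ a ∈ top, v ≤ w a)
    {i x : Fin n} (hi : 2 * u < w i) (hx : x ∉ top) (hj : w j ≤ w i)
    (hjx : j ∈ top ∨ v / 2 ≤ w j) : 1 / 12 ≤ winProb w i j - winProb w x j := by
  have hi0 := hw i; have hx0 := hw x; have hj0 := hw j
  have hxu := hu x hx
  have hjx' : w x ≤ 2 * w j := by
    rcases hjx with h | h
    · linarith [hv j h]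
    · linarith
  rw [winProb_sub hw, div_mul_div_comm, div_le_div_iff₀ (by norm_num) (by positivity)]
  have e1 : w i ≤ 2 * (w i - w x) := by linarith
  have e2 : w i + w j ≤ 4 * (w i - w x) := by linarith
  have e3 : w x + w j ≤ 3 * w j := by linarith
  nlinarith [mul_le_mul e2 e3 (by positivity) (by linarith)]

/-- Here the scores enter through w i + w j ≤ 2 w j and w x + w j ≤ 3 w x ≤ 6 (w x − w i), whence
1/2 · 1/6. -/
theorem bot_gap_of_far (hw : ∀ a, 0 < w a) (hu : ∀ a ∉ top, w a ≤ u) (huv : u < v)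
    (hv : ∀ a ∈ top, v ≤ w a)
    {i x : Fin n} (hi : w i < v / 2) (hx : x ∈ top) (hj : w i ≤ w j)
    (hjx : j ∉ top ∨ w j ≤ 2 * u) : 1 / 12 ≤ winProb w x j - winProb w i j := by
  have hi0 := hw i; have hx0 := hw x; have hj0 := hw j
  have hxv := hv x hx
  have hjx' : w j ≤ 2 * w x := by
    rcases hjx with h | h
    · linarith [hu j h]
    · linarith
  rw [winProb_sub hw, div_mul_div_comm, div_le_div_iff₀ (by norm_num) (by positivity)]
  have e2 : w x + w j ≤ 6 * (w x - w i) := by linarith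
  have e3 : w i + w j ≤ 2 * w j := by linarith
  nlinarith [mul_le_mul e2 e3 (by positivity) (by linarith)]

/-- Accuracy 1/64 decides every gap above 4/64 < 1/12. By the two preceding bounds a pivot that is
not far leaves no far candidate undecided, and a far pivot leaves on its own side only those
strictly closer to the threshold. -/
theorem four_mul_sum_card_far_le (hw : ∀ a, 0 < w a) (hu : ∀ a ∉ top, w a ≤ u) (huv : u < v)
    (hv : ∀ a ∈ top, v ≤ w a) (A : Finset (Fin n)) (G : Fin n → Finset (Fin n))
    (hG : ∀ j ∈ A, ∃ e : Fin n → ℝ, (∀ i ∈ A, |e i - winProb w i j| ≤ 1 / 64) ∧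
      G j = far w top u v (undecided A (A ∩ top).card (1 / 64) e)) :
    4 * ∑ j ∈ A, (G j).card ≤ 3 * ((far w top u v A).card * A.card) := by
  classical
  have hGj : ∀ j ∈ A, ∀ i ∈ G j, i ∈ far w top u v A ∧
      (i ∈ top → 2 * u < w i ∧ ∃ x ∉ top, winProb w i j - winProb w x j < 1 / 12) ∧
      (i ∉ top → w i < v / 2 ∧ ∃ x ∈ top, winProb w x j - winProb w i j < 1 / 12) := by
    intro j hj i hi
    obtain ⟨e, hacc, hGe⟩ := hG j hj
    rw [hGe] at hi
    obtain ⟨hiU, hif⟩ := Finset.mem_filter.1 hi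
    refine ⟨Finset.mem_filter.2 ⟨(Finset.mem_sdiff.1 hiU).1, hif⟩, fun hit => ⟨?_, ?_⟩,
      fun hit => ⟨?_, ?_⟩⟩
    · tauto
    · obtain ⟨x, _, hx, h⟩ := exists_of_undecided_top hacc hiU
      exact ⟨x, hx, by linarith⟩
    · tauto
    · obtain ⟨x, _, hx, h⟩ := exists_of_undecided_bot hacc hiU
      exact ⟨x, hx, by linarith⟩
  refine four_mul_sum_card_le w top A _ (Finset.filter_subset _ _) G
    (fun j hj i hi => (hGj j hj i hi).1) ?_ ?_ ?_
  · intro j hj hjF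
    refine Finset.eq_empty_of_forall_notMem fun i hi => ?_
    obtain ⟨_, h1, h2⟩ := hGj j hj i hi
    have hjF' : (j ∈ top → w j ≤ 2 * u) ∧ (j ∉ top → v / 2 ≤ w j) := by
      constructor
      · intro h; by_contra! h'; exact hjF (Finset.mem_filter.2 ⟨hj, Or.inl ⟨h, h'⟩⟩)
      · intro h; by_contra! h'; exact hjF (Finset.mem_filter.2 ⟨hj, Or.inr ⟨h, h'⟩⟩)
    by_cases hit : i ∈ top
    · obtain ⟨h3, x, hx, h4⟩ := h1 hit
      refine absurd h4 (not_lt.2 (top_gap_of_far hw hu huv hv h3 hx ?_ ?_))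
      · by_cases hjt : j ∈ top
        · linarith [hjF'.1 hjt]
        · linarith [hu j hjt, hv i hit]
      · by_cases hjt : j ∈ top
        · exact Or.inl hjt
        · exact Or.inr (hjF'.2 hjt)
    · obtain ⟨h3, x, hx, h4⟩ := h2 hit
      refine absurd h4 (not_lt.2 (bot_gap_of_far hw hu huv hv h3 hx ?_ ?_))
      · by_cases hjt : j ∈ top
        · linarith [hv j hjt, hu i hit]
        · linarith [hjF'.2 hjt]
      · by_cases hjt : j ∈ top
        · exact Or.inr (hjF'.1 hjt)
        · exact Or.inl hjt
  · intro j hj hjt i hi hit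
    obtain ⟨h3, x, hx, h4⟩ := (hGj j (Finset.filter_subset _ _ hj) i hi).2.1 hit
    by_contra! hle
    exact absurd h4 (not_lt.2 (top_gap_of_far hw hu huv hv h3 hx hle (Or.inl hjt)))
  · intro j hj hjt i hi hit
    obtain ⟨h3, x, hx, h4⟩ := (hGj j (Finset.filter_subset _ _ hj) i hi).2.2 hit
    by_contra! hle
    exact absurd h4 (not_lt.2 (bot_gap_of_far hw hu huv hv h3 hx hle (Or.inl hjt)))

theorem mem_Icc_of_near (hw : ∀ a, 0 < w a) (hu : ∀ a ∉ top, w a ≤ u) (hv : ∀ a ∈ top, v ≤ w a)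
    (hA : far w top u v A = ∅) {x i : Fin n} (hx : x ∈ A) (hxt : x ∉ top) (hi : i ∈ A)
    (hit : i ∈ top) {a : Fin n} (ha : a ∈ A) : v / 2 ≤ w a ∧ w a ≤ 2 * u := by
  have near : ∀ a ∈ A, (a ∈ top → w a ≤ 2 * u) ∧ (a ∉ top → v / 2 ≤ w a) := by
    intro a ha
    have : a ∉ far w top u v A := by rw [hA]; exact Finset.notMem_empty _
    constructor
    · intro h; by_contra! h'; exact this (Finset.mem_filter.2 ⟨ha, Or.inl ⟨h, h'⟩⟩)
    · intro h; by_contra! h'; exact this (Finset.mem_filter.2 ⟨ha, Or.inr ⟨h, h'⟩⟩)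
  have h1 := (near x hx).2 hxt
  have h2 := (near i hi).1 hit
  have h3 := hu x hxt
  have h4 := hv i hit
  by_cases hat : a ∈ top
  · exact ⟨by linarith [hv a hat, hw a], (near a ha).1 hat⟩
  · exact ⟨(near a ha).2 hat, by linarith [hu a hat, hw a]⟩

/-- Without far candidates all scores involved are comparable with u and v, so a difference of win
probabilities is at least (relative gap)/24: the denominator in `winProb_sub` is at most 4u · 3u and
the pivot's score at least u/2 (likewise with v). Undecided candidates have a difference of at most
4ε. -/
theorem relGap_undecided_le (hw : ∀ a, 0 < w a) (hu : ∀ a ∉ top, w a ≤ u) (huv : u < v)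
    (hu0 : 0 < u) (hv : ∀ a ∈ top, v ≤ w a) (hA : far w top u v A = ∅) (hj : j ∈ A)
    (hacc : ∀ i ∈ A, |e i - winProb w i j| ≤ ε) {i : Fin n}
    (hi : i ∈ undecided A (A ∩ top).card ε e) : relGap w top u v i ≤ 96 * ε := by
  have hiA := (Finset.mem_sdiff.1 hi).1
  have hi0 := hw i; have hj0 := hw j
  by_cases hit : i ∈ top
  · obtain ⟨x, hxA, hxt, h⟩ := exists_of_undecided_top hacc hi
    have hx0 := hw x
    have ij := mem_Icc_of_near hw hu hv hA hxA hxt hiA hit hj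
    have ii := mem_Icc_of_near hw hu hv hA hxA hxt hiA hit hiA
    have hxu := hu x hxt
    have hiv := hv i hit
    rw [relGap, if_pos hit]
    rw [winProb_sub hw, div_mul_div_comm, div_le_iff₀ (by positivity)] at h
    have hε : 0 ≤ ε := (abs_nonneg _).trans (hacc i hiA)
    rw [div_le_iff₀ hu0]
    have e1 : (w i + w j) * (w x + w j) ≤ (4 * u) * (3 * u) :=
      mul_le_mul (by linarith) (by linarith) (by positivity) (by positivity)
    have e2 : u / 2 * (w i - u) ≤ w j * (w i - w x) :=
      mul_le_mul (by linarith) (by linarith) (by linarith) hj0.le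
    have e3 := mul_le_mul_of_nonneg_left e1 (by positivity : 0 ≤ 4 * ε)
    have e4 : u * (w i - u) ≤ u * (96 * ε * u) := by linarith
    exact le_of_mul_le_mul_left e4 hu0
  · obtain ⟨x, hxA, hxt, h⟩ := exists_of_undecided_bot hacc hi
    have hx0 := hw x
    have hv0 : 0 < v := hu0.trans huv
    have ij := mem_Icc_of_near hw hu hv hA hiA hit hxA hxt hj
    have ix := mem_Icc_of_near hw hu hv hA hiA hit hxA hxt hxA
    have hiu := hu i hit
    have hxv := hv x hxt
    rw [relGap, if_neg hit]
    rw [winProb_sub hw, div_mul_div_comm, div_le_iff₀ (by positivity)] at h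
    have hε : 0 ≤ ε := (abs_nonneg _).trans (hacc i hiA)
    rw [div_le_iff₀ hv0]
    have e1 : (w x + w j) * (w i + w j) ≤ (4 * v) * (3 * v) :=
      mul_le_mul (by linarith) (by linarith) (by positivity) (by positivity)
    have e2 : v / 2 * (v - w i) ≤ w j * (w x - w i) :=
      mul_le_mul (by linarith) (by linarith) (by linarith) hj0.le
    have e3 := mul_le_mul_of_nonneg_left e1 (by positivity : 0 ≤ 4 * ε)
    have e4 : v * (v - w i) ≤ v * (96 * ε * v) := by linarith
    exact le_of_mul_le_mul_left e4 hv0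

theorem relGap_le_one (hw : ∀ a, 0 < w a) (hu0 : 0 < u) (huv : u < v)
    (hA : far w top u v A = ∅) {i : Fin n} (hi : i ∈ A) : relGap w top u v i ≤ 1 := by
  have : i ∉ far w top u v A := by rw [hA]; exact Finset.notMem_empty _
  have hi0 := hw i
  rw [relGap]
  split_ifs with h
  · rw [div_le_one hu0]
    by_contra! h'
    exact this (Finset.mem_filter.2 ⟨hi, Or.inl ⟨h, by linarith⟩⟩)
  · rw [div_le_one (hu0.trans huv)]; linarith

/-- Ends the refinement: no candidate survives once the bound on the relative gaps is below (v −
u)/v. -/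
theorem le_relGap (hu : ∀ a ∉ top, w a ≤ u) (huv : u < v)
    (hu0 : 0 < u) (hv : ∀ a ∈ top, v ≤ w a) (i : Fin n) :
    (v - u) / v ≤ relGap w top u v i := by
  have hv0 : 0 < v := hu0.trans huv
  rw [relGap]
  split_ifs with h
  · have := hv i h
    exact (div_le_div_of_nonneg_left (by linarith) hu0 huv.le).trans (by gcongr)
  · have := hu i h
    gcongr

end Far

end TopK
end
-- The algorithm
noncomputable section

variable {n : ℕ}

namespace TopK

/-- The algorithm first counts the wins of labels in random comparisons, then accepts and rejects
candidates by comparing them with a random candidate. -/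
inductive Phase (n : ℕ) : Type
  | count (c : Fin n → ℕ)
  | refine (t : ℕ) (A Acc : Finset (Fin n))

/-- Size of the random comparisons, number of wins to be reached, number of rounds of constant
accuracy, and confidence parameter. -/
structure Params where
  size : ℕ
  wins : ℕ
  coarse : ℕ
  conf : ℕ

namespace Params

variable (P : Params)

def samples (t : ℕ) : ℕ := 2 ^ 14 * 4 ^ (t - P.coarse) * (P.conf + t + 2)

def radius (t : ℕ) : ℝ := (1 / 2) ^ (t - P.coarse) / 64

theorem samples_ne_zero (t : ℕ) : P.samples t ≠ 0 := by unfold samples; positivity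

theorem radius_pos (t : ℕ) : 0 < P.radius t := by unfold radius; positivity

theorem radius_le_one (t : ℕ) : P.radius t ≤ 1 := by
  unfold radius
  have : ((1 : ℝ) / 2) ^ (t - P.coarse) ≤ 1 := pow_le_one₀ (by norm_num) (by norm_num)
  linarith

theorem samples_mul_radius (t : ℕ) :
    (P.samples t : ℝ) * P.radius t ^ 2 / 4 = P.conf + t + 2 := by
  have h : (4 : ℝ) ^ (t - P.coarse) * ((1 / 2) ^ (t - P.coarse)) ^ 2 = 1 := by
    rw [← pow_mul, mul_comm (t - P.coarse) 2, pow_mul, ← mul_pow]; norm_num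
  unfold samples radius
  push_cast
  calc _ = ((4 : ℝ) ^ (t - P.coarse) * ((1 / 2) ^ (t - P.coarse)) ^ 2) *
      ((P.conf + t + 2) * (2 ^ 14 / 64 ^ 2 / 4)) := by ring
    _ = _ := by rw [h]; norm_num

end Params

open RoundAlgorithm

variable (k l : ℕ) (P : Params)

def afterCount (c : Fin n → ℕ) : Phase n :=
  if k ≤ (Finset.univ.filter fun a => P.wins ≤ c a).card then
    .refine 0 (Finset.univ.filter fun a => 1 ≤ c a) ∅
  else .count c

def afterRefine (t : ℕ) (A Acc : Finset (Fin n)) (j : Fin n) (as : List (Fin n)) : Phase n :=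
  .refine (t + 1) (undecided A (k - Acc.card) (P.radius t) (estimate j (P.samples t) as))
    (Acc ∪ accepted A (k - Acc.card) (P.radius t) (estimate j (P.samples t) as))

def plan : Phase n → PMF (List (Query n l) × (List (Fin n) → Phase n)) ⊕ Finset (Fin n)
  | .count c =>
    if h : (Finset.univ.filter fun q : Query n l => q.1.card = P.size).Nonempty then
      Sum.inl ((PMF.uniformOfFinset _ h).map fun q =>
        ([q], fun as => afterCount k P fun a => c a + as.count a))
    -- A default value; sets of the required size exist in the runs that matter, by
    -- `queries_nonempty`.
    else Sum.inr ∅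
  | .refine t A Acc =>
    if _h0 : k ≤ Acc.card then Sum.inr Acc
    else if h : A.card + Acc.card ≤ k then Sum.inr (Acc ∪ A)
    else Sum.inl ((PMF.uniformOfFinset A (Finset.card_pos.1 (by omega))).map fun j =>
      (pairQueries l A j (P.samples t), afterRefine k P t A Acc j))

abbrev algorithm (n k l : ℕ) (P : Params) : RoundAlgorithm n l where
  Conf := Phase n
  start := if 8 * k ≤ n then .count 0 else .refine 0 Finset.univ ∅
  plan := plan k l P

/-! ### Failure probability of the refinement -/

section Refine

variable {k l P}
variable {w : Fin n → ℝ} (hw : ∀ a, 0 < w a) {top A Acc : Finset (Fin n)}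

/-- The failure probability of the rounds from the `t`-th one on, for at most `n` candidates. -/
def tailBound (n K t : ℕ) : ℝ≥0∞ := n * 2⁻¹ ^ (K + t)

theorem tailBound_succ_add (n K t : ℕ) :
    tailBound n K (t + 1) + tailBound n K (t + 1) = tailBound n K t := by
  unfold tailBound
  rw [← mul_add, ← add_assoc K t 1, pow_succ, ← mul_add, ENNReal.inv_two_add_inv_two, mul_one]

/-- The constant 2 ^ 14 in `samples` makes the Chernoff exponent exactly conf + t + 2; of the
resulting power of 1/2, one factor cancels the 2 of the two-sided bound. -/
theorem card_mul_exp_le (A : Finset (Fin n)) (P : Params) (t : ℕ) :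
    (A.card : ℝ≥0∞) * (2 * ENNReal.ofReal (Real.exp (-(P.samples t * P.radius t ^ 2 / 4)))) ≤
      tailBound n P.conf (t + 1) := by
  rw [P.samples_mul_radius]
  have h1 : Real.exp (-((P.conf : ℝ) + t + 2)) ≤ (1 / 2) ^ (P.conf + t + 2) := by
    have h2 : Real.exp (-1) ≤ 1 / 2 := by
      rw [Real.exp_neg, one_div]
      exact inv_anti₀ (by norm_num) (by have := Real.add_one_le_exp 1; linarith)
    have : Real.exp (-((P.conf : ℝ) + t + 2)) = Real.exp (-1) ^ (P.conf + t + 2) := by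
      rw [← Real.exp_nat_mul]; push_cast; ring_nf
    rw [this]
    exact pow_le_pow_left₀ (Real.exp_pos _).le h2 _
  have h3 : ENNReal.ofReal (Real.exp (-((P.conf : ℝ) + t + 2))) ≤ 2⁻¹ ^ (P.conf + t + 2) := by
    refine (ENNReal.ofReal_le_ofReal h1).trans (le_of_eq ?_)
    rw [ENNReal.ofReal_pow (by norm_num), one_div, ENNReal.ofReal_inv_of_pos (by norm_num)]
    simp
  unfold tailBound
  refine mul_le_mul' (by exact_mod_cast A.card_le_univ.trans_eq (Fintype.card_fin n)) ?_
  calc _ ≤ 2 * (2⁻¹ : ℝ≥0∞) ^ (P.conf + t + 2) := by gcongr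
    _ = _ := by
      rw [show P.conf + t + 2 = (P.conf + (t + 1)) + 1 by ring, pow_succ, mul_comm, mul_assoc,
        ENNReal.inv_mul_cancel (by simp) (by simp), mul_one]

theorem fail_refine_halt (h : Consistent top A Acc) (hk : top.card = k)
    (hh : k ≤ Acc.card ∨ A.card + Acc.card ≤ k) (t N : ℕ) :
    (algorithm n k l P).fail w hw top N (.refine t A Acc) = 0 := by
  have hc := h.card
  have h3 : (A ∩ top).card ≤ A.card := Finset.card_le_card Finset.inter_subset_left
  refine RoundAlgorithm.fail_halt _ _ _ ?_
  change plan k l P (.refine t A Acc) = _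
  by_cases h1 : k ≤ Acc.card
  · have h2 : A ∩ top = ∅ := Finset.card_eq_zero.1 (by omega)
    have h4 := h.union
    rw [h2, Finset.union_empty] at h4
    rw [plan, dif_pos h1, h4]
  · have h2 := hh.resolve_left h1
    have h4 : A ∩ top = A := Finset.eq_of_subset_of_card_le Finset.inter_subset_left (by omega)
    have h5 := h.union
    rw [h4] at h5
    rw [plan, dif_neg h1, dif_pos h2, h5]

/-- The next state depends on the winners only through the estimates, so φ j need only dominate the
failure after arbitrary accurate estimates. The remaining budget N' is a variable because the round
may use fewer comparisons than the bound `A.card * P.samples t`. -/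
theorem fail_refine_step (hl : 2 ≤ l) (h : Consistent top A Acc) (hk : top.card = k)
    (hA : A.Nonempty) (t N : ℕ) (hN : A.card * P.samples t ≤ N) (φ : Fin n → ℝ≥0∞)
    (hφ : ∀ j ∈ A, ∀ e : Fin n → ℝ, (∀ i ∈ A, |e i - winProb w i j| ≤ P.radius t) →
      ∀ N', N ≤ N' + A.card * P.samples t →
        (algorithm n k l P).fail w hw top N' (.refine (t + 1)
          (undecided A (A ∩ top).card (P.radius t) e)
          (Acc ∪ accepted A (A ∩ top).card (P.radius t) e)) ≤ φ j) :
    (algorithm n k l P).fail w hw top N (.refine t A Acc) ≤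
      tailBound n P.conf (t + 1) + (A.card : ℝ≥0∞)⁻¹ * ∑ j ∈ A, φ j := by
  classical
  by_cases hh : k ≤ Acc.card ∨ A.card + Acc.card ≤ k
  · rw [fail_refine_halt hw h hk hh]; exact zero_le
  push Not at hh
  have hkc : k - Acc.card = (A ∩ top).card := by have := h.card; omega
  have hplan : (algorithm n k l P).plan (.refine t A Acc) =
      Sum.inl ((PMF.uniformOfFinset A hA).map fun j =>
        (pairQueries l A j (P.samples t), afterRefine k P t A Acc j)) := by
    change plan k l P (.refine t A Acc) = _
    rw [plan, dif_neg hh.1.not_ge, dif_neg hh.2.not_ge]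
  rw [RoundAlgorithm.fail_step _ _ _ hplan, PMF.expect_map]
  swap
  · intro x hx
    obtain ⟨j, _, rfl⟩ := (PMF.mem_support_map_iff _ _ _).1 hx
    exact ⟨pairQueries_ne_nil hl (by omega) j (P.samples_ne_zero t),
      (length_pairQueries_le A j _).trans hN⟩
  calc _ ≤ (PMF.uniformOfFinset A hA).expect
        (fun j => tailBound n P.conf (t + 1) + φ j) := by
        refine PMF.expect_mono _ fun j hj => ?_
        have hjA : j ∈ A := (PMF.mem_support_uniformOfFinset_iff hA j).1 hj
        refine le_trans (PMF.expect_mono (g := fun as =>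
          (if ∀ i ∈ A, |estimate j (P.samples t) as i - winProb w i j| ≤ P.radius t
            then 0 else 1) + φ j) _ fun as _ => ?_) ?_
        · split_ifs with hacc
          · rw [zero_add]
            have := hφ j hjA _ hacc (N - (pairQueries l A j (P.samples t)).length) (by
              have := length_pairQueries_le (l := l) A j (P.samples t)
              omega)
            rw [← hkc] at this
            exact this
          · exact (RoundAlgorithm.fail_le_one _ _ _ _ _ _).trans le_self_add
        · rw [PMF.expect_add, PMF.expect_const]
          gcongr
          exact (expect_draw_inaccurate w hw hl A j (P.samples_ne_zero t) (P.radius_pos t)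
            (P.radius_le_one t)).trans (card_mul_exp_le A P t)
    _ = _ := by
        rw [PMF.expect_add, PMF.expect_const, PMF.expect_uniformOfFinset]

theorem average_const {A : Finset (Fin n)} (hA : A.Nonempty) (x : ℝ≥0∞) :
    (A.card : ℝ≥0∞)⁻¹ * ∑ _j ∈ A, x = x := by
  rw [Finset.sum_const, nsmul_eq_mul, ← mul_assoc, ENNReal.inv_mul_cancel, one_mul]
  · exact_mod_cast hA.card_pos.ne'
  · exact ENNReal.natCast_ne_top _

variable {u v : ℝ}

/-- The invariant is relGap ≤ 3 · 2^(−r). At r = R it contradicts `le_relGap` unless no candidate is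
left. -/
theorem fail_refine_fine (hl : 2 ≤ l) (hk : top.card = k) (hu : ∀ a ∉ top, w a ≤ u)
    (huv : u < v) (hu0 : 0 < u) (hv : ∀ a ∈ top, v ≤ w a) {R B : ℕ}
    (hR : 3 * (1 / 2 : ℝ) ^ R < (v - u) / v)
    (hB : ∀ (r : ℕ) (A : Finset (Fin n)), r ≤ R → far w top u v A = ∅ →
      (∀ i ∈ A, relGap w top u v i ≤ 3 * (1 / 2) ^ r) →
        A.card * P.samples (P.coarse + r) ≤ B) (d : ℕ) :
    ∀ (r N : ℕ) (A Acc : Finset (Fin n)), r + d = R → Consistent top A Acc →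
      far w top u v A = ∅ → (∀ i ∈ A, relGap w top u v i ≤ 3 * (1 / 2) ^ r) → d * B ≤ N →
      (algorithm n k l P).fail w hw top N (.refine (P.coarse + r) A Acc) ≤
        tailBound n P.conf (P.coarse + r) := by
  have hsep : ∀ a ∈ top, ∀ b ∉ top, w b < w a := fun a ha b hb =>
    (hu b hb).trans_lt (huv.trans_le (hv a ha))
  have hempty : ∀ (t N : ℕ) (Acc : Finset (Fin n)), Consistent top ∅ Acc →
      (algorithm n k l P).fail w hw top N (.refine t ∅ Acc) = 0 := by
    intro t N Acc h
    refine fail_refine_halt hw h hk (Or.inl ?_) t N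
    have := h.card
    simp at this
    omega
  induction d with
  | zero =>
    intro r N A Acc hr h hA hgap _
    obtain rfl : A = ∅ := by
      refine Finset.eq_empty_of_forall_notMem fun i hi => ?_
      have h1 := hgap i hi
      have h2 := le_relGap hu huv hu0 hv i
      obtain rfl : r = R := by omega
      linarith
    rw [hempty _ _ _ h]
    exact zero_le
  | succ d ih =>
    intro r N A Acc hr h hA hgap hN
    rcases A.eq_empty_or_nonempty with rfl | hAne
    · rw [hempty _ _ _ h]
      exact zero_le
    have hcost := hB r A (by omega) hA hgap
    have hrad : P.radius (P.coarse + r) = (1 / 2) ^ r / 64 := by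
      simp [Params.radius]
    refine (fail_refine_step hw hl h hk hAne _ N (hcost.trans (by nlinarith))
      (fun _ => tailBound n P.conf (P.coarse + r + 1)) ?_).trans ?_
    · intro j hj e hacc N' hN'
      refine ih (r + 1) N' _ _ (by omega) (h.next hw hsep hacc) ?_ ?_ ?_
      · refine Finset.eq_empty_of_forall_notMem fun i hi => ?_
        obtain ⟨hi, hif⟩ := Finset.mem_filter.1 hi
        have : i ∈ far w top u v A := Finset.mem_filter.2 ⟨(Finset.mem_sdiff.1 hi).1, hif⟩
        rw [hA] at this
        exact Finset.notMem_empty _ this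
      · intro i hi
        -- 96/64 · 2^(−r) = 3 · 2^(−(r+1)).
        refine (relGap_undecided_le hw hu huv hu0 hv hA hj hacc hi).trans (le_of_eq ?_)
        rw [hrad, pow_succ]
        ring
      · have : (d + 1) * B = d * B + B := by ring
        omega
    · rw [average_const hAne, tailBound_succ_add]

/-- The number of far candidates is a potential. At d = 0 it is either zero, and the fine rounds
take over, or at least one, and the bound is trivial. -/
theorem fail_refine_coarse (hl : 2 ≤ l) (hk : top.card = k) (hu : ∀ a ∉ top, w a ≤ u)
    (huv : u < v) (hu0 : 0 < u) (hv : ∀ a ∈ top, v ≤ w a) {R B : ℕ}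
    (hR : 3 * (1 / 2 : ℝ) ^ R < (v - u) / v)
    (hB : ∀ (r : ℕ) (A : Finset (Fin n)), r ≤ R → far w top u v A = ∅ →
      (∀ i ∈ A, relGap w top u v i ≤ 3 * (1 / 2) ^ r) →
        A.card * P.samples (P.coarse + r) ≤ B) {S : ℕ} (d : ℕ) :
    ∀ (t N : ℕ) (A Acc : Finset (Fin n)), t + d = P.coarse → Consistent top A Acc →
      A.card ≤ S → d * (S * P.samples P.coarse) + R * B ≤ N →
      (algorithm n k l P).fail w hw top N (.refine t A Acc) ≤
        (far w top u v A).card * ENNReal.ofReal (3 / 4) ^ d + tailBound n P.conf t := by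
  have hsep : ∀ a ∈ top, ∀ b ∉ top, w b < w a := fun a ha b hb =>
    (hu b hb).trans_lt (huv.trans_le (hv a ha))
  induction d with
  | zero =>
    intro t N A Acc ht h hA hN
    rcases (far w top u v A).eq_empty_or_nonempty with hF | hF
    · refine le_trans ?_ le_add_self
      obtain rfl : t = P.coarse := by omega
      refine fail_refine_fine hw hl hk hu huv hu0 hv hR hB R 0 N A Acc (by omega) h hF ?_ (by omega)
      intro i hi
      have := relGap_le_one hw hu0 huv hF hi
      norm_num
      linarith
    · refine (RoundAlgorithm.fail_le_one _ _ _ _ _ _).trans (le_trans ?_ le_self_add)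
      rw [pow_zero, mul_one]
      exact_mod_cast hF.card_pos
  | succ d ih =>
    intro t N A Acc ht h hA hN
    rcases A.eq_empty_or_nonempty with rfl | hAne
    · rw [fail_refine_halt hw h hk (Or.inl ?_) t N]
      · exact zero_le
      · have := h.card
        simp at this
        omega
    have hrad : P.radius t = 1 / 64 := by
      rw [Params.radius, Nat.sub_eq_zero_of_le (by omega), pow_zero]
    have hs : P.samples t ≤ P.samples P.coarse := by
      unfold Params.samples
      rw [Nat.sub_eq_zero_of_le (show t ≤ P.coarse by omega), Nat.sub_self]
      gcongr
      omega
    have hcost : A.card * P.samples t ≤ S * P.samples P.coarse := Nat.mul_le_mul hA hs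
    have hN2 : (d + 1) * (S * P.samples P.coarse) =
      d * (S * P.samples P.coarse) + S * P.samples P.coarse := by ring
    classical
    set q := ENNReal.ofReal (3 / 4) with hq
    -- the worst accurate estimate for each candidate
    have hworst : ∀ j : Fin n, ∃ G : Finset (Fin n),
        (∃ e : Fin n → ℝ, (∀ i ∈ A, |e i - winProb w i j| ≤ 1 / 64) ∧
          G = far w top u v (undecided A (A ∩ top).card (1 / 64) e)) ∧
        ∀ e : Fin n → ℝ, (∀ i ∈ A, |e i - winProb w i j| ≤ 1 / 64) →
          (far w top u v (undecided A (A ∩ top).card (1 / 64) e)).card ≤ G.card := by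
      intro j
      set 𝒢 := Finset.univ.filter fun G : Finset (Fin n) =>
        ∃ e : Fin n → ℝ, (∀ i ∈ A, |e i - winProb w i j| ≤ 1 / 64) ∧
          G = far w top u v (undecided A (A ∩ top).card (1 / 64) e)
      obtain ⟨G, hG, hmax⟩ := 𝒢.exists_max_image Finset.card
        ⟨_, Finset.mem_filter.2 ⟨Finset.mem_univ _, fun i => winProb w i j,
          fun i _ => by simp, rfl⟩⟩
      exact ⟨G, (Finset.mem_filter.1 hG).2, fun e he =>
        hmax _ (Finset.mem_filter.2 ⟨Finset.mem_univ _, e, he, rfl⟩)⟩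
    choose G hG hGmax using hworst
    -- Fixing one worst outcome per pivot removes the randomness of the answers, so that only the
    -- average over the pivot remains.
    have hcontr := four_mul_sum_card_far_le hw hu huv hv A G fun j _ => hG j
    refine (fail_refine_step hw hl h hk hAne t N (by omega)
      (fun j => (G j).card * q ^ d + tailBound n P.conf (t + 1)) ?_).trans ?_
    · intro j hj e hacc N' hN'
      have hU : (undecided A (A ∩ top).card (P.radius t) e).card ≤ S :=
        (Finset.card_le_card Finset.sdiff_subset).trans hA
      refine (ih (t + 1) N' _ _ (by omega) (h.next hw hsep hacc) hU (by omega)).trans ?_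
      rw [hrad] at hacc ⊢
      have := hGmax j e hacc
      gcongr ?_ * _ + _
      exact_mod_cast this
    · rw [Finset.sum_add_distrib, mul_add, average_const hAne, ← add_assoc, add_right_comm,
        tailBound_succ_add, add_comm]
      refine add_le_add_left ?_ _
      rw [← Finset.sum_mul, ← mul_assoc, pow_succ', ← mul_assoc]
      refine mul_le_mul_left ?_ _
      have hA0 : (0 : ℝ) < A.card := by exact_mod_cast hAne.card_pos
      have e1 : (A.card : ℝ≥0∞) = ENNReal.ofReal A.card := by simp
      have e2 : ((far w top u v A).card : ℝ≥0∞) = ENNReal.ofReal (far w top u v A).card := by simp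
      have e3 : ∑ j ∈ A, ((G j).card : ℝ≥0∞) = ENNReal.ofReal (∑ j ∈ A, (G j).card : ℕ) := by
        rw [ENNReal.ofReal_natCast, Nat.cast_sum]
      rw [e1, e2, e3, hq, ← ENNReal.ofReal_inv_of_pos hA0, ← ENNReal.ofReal_mul (by positivity),
        ← ENNReal.ofReal_mul (by positivity)]
      refine ENNReal.ofReal_le_ofReal ?_
      rw [inv_mul_le_iff₀ hA0]
      have : (4 : ℝ) * (∑ j ∈ A, (G j).card : ℕ) ≤ 3 * ((far w top u v A).card * A.card) := by
        exact_mod_cast hcontr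
      linarith

end Refine

end TopK
end
-- Win rates in random comparisons
noncomputable section

variable {n : ℕ}

namespace TopK

section Rate

/-- The probability that `i` wins a comparison of `s` labels chosen uniformly at random. -/
def rate (w : Fin n → ℝ) (s : ℕ) (i : Fin n) : ℝ :=
  (∑ Q ∈ Finset.powersetCard s (Finset.univ : Finset (Fin n)),
    if i ∈ Q then w i / ∑ a ∈ Q, w a else 0) / n.choose s

variable {w : Fin n → ℝ}

theorem rate_nonneg (hw : ∀ a, 0 < w a) (s : ℕ) (i : Fin n) : 0 ≤ rate w s i := by
  refine div_nonneg (Finset.sum_nonneg fun Q _ => ?_) (Nat.cast_nonneg _)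
  split_ifs
  · exact div_nonneg (hw i).le (Finset.sum_nonneg fun a _ => (hw a).le)
  · exact le_rfl

/-- Swapping i and j is a bijection of the s-sets. It turns a set containing i into one containing
j, where j faces competitors of at least the same total score. -/
theorem rate_le_rate (hw : ∀ a, 0 < w a) (s : ℕ) {i j : Fin n} (hij : w j ≤ w i) : rate w s j ≤ rate w s i := by
  classical
  rcases eq_or_ne i j with rfl | hne
  · exact le_rfl
  set σ : Equiv.Perm (Fin n) := Equiv.swap i j with hσ
  unfold rate
  refine div_le_div_of_nonneg_right ?_ (Nat.cast_nonneg _)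
  have h1 : ∑ Q ∈ Finset.powersetCard s (Finset.univ : Finset (Fin n)),
      (if j ∈ Q then w j / ∑ a ∈ Q, w a else 0) =
      ∑ Q ∈ Finset.powersetCard s (Finset.univ : Finset (Fin n)),
        (if j ∈ Q.map σ.toEmbedding then w j / ∑ a ∈ Q.map σ.toEmbedding, w a else 0) := by
    refine (Finset.sum_equiv (Equiv.finsetCongr σ) ?_ ?_).symm
    · intro Q; simp [Finset.mem_powersetCard]
    · intro Q _; rfl
  rw [h1]
  refine Finset.sum_le_sum fun Q _ => ?_
  have h2 : j ∈ Q.map σ.toEmbedding ↔ i ∈ Q := by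
    rw [Finset.mem_map_equiv, hσ, Equiv.symm_swap, Equiv.swap_apply_right]
  simp only [h2]
  split_ifs with hi
  · rw [Finset.sum_map]
    have e1 := Finset.add_sum_erase Q w hi
    have e2 := Finset.add_sum_erase Q (fun a => w (σ a)) hi
    have e3 : w (σ i) = w j := by rw [hσ, Equiv.swap_apply_left]
    have e4 : ∑ a ∈ Q.erase i, w a ≤ ∑ a ∈ Q.erase i, w (σ a) := by
      refine Finset.sum_le_sum fun a ha => ?_
      have hai := Finset.ne_of_mem_erase ha
      by_cases haj : a = j
      · rw [haj, hσ, Equiv.swap_apply_right]; exact hij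
      · rw [hσ, Equiv.swap_apply_of_ne_of_ne hai haj]
    have e5 : 0 ≤ ∑ a ∈ Q.erase i, w a := Finset.sum_nonneg fun a _ => (hw a).le
    have hi0 := hw i; have hj0 := hw j
    simp only [Equiv.toEmbedding_apply, ← e1, ← e2, e3]
    rw [div_le_div_iff₀ (by linarith) (by linarith)]
    nlinarith [mul_le_mul hij e4 e5 hi0.le]
  · exact le_rfl

/-- Replaces a win probability by a bound linear in x and y: the tangent of 1/(1 + x) at x0 if y =
0, and something nonpositive if y ≥ 1. -/
theorem tangent_le {x x0 y a b : ℝ} (hx0 : 0 ≤ x0) (hx : 0 ≤ x) (ha : 0 < a)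
    (hy : (y = 0 ∧ b ≤ a * (1 + x)) ∨ 1 ≤ y) (hs : 0 < b) :
    ((1 + 2 * x0) * (1 - y) - x) / (1 + x0) ^ 2 ≤ a / b := by
  rcases hy with ⟨rfl, h⟩ | hy
  · have h1 : ((1 + 2 * x0) * (1 - 0) - x) / (1 + x0) ^ 2 ≤ 1 / (1 + x) := by
      rw [div_le_div_iff₀ (by positivity) (by positivity)]
      nlinarith [sq_nonneg (x - x0)]
    refine h1.trans ?_
    rw [div_le_div_iff₀ (by positivity) hs]
    linarith
  · refine le_trans ?_ (div_pos ha hs).le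
    refine div_nonpos_of_nonpos_of_nonneg ?_ (by positivity)
    nlinarith

/-- For a set Q containing i, let y count the other top items in Q and let x be the total score of
its non-top items over v. The linear bound of `tangent_le` can be averaged knowing only how often a
second label lies in Q. -/
theorem le_rate (hw : ∀ a, 0 < w a) {top : Finset (Fin n)} {v : ℝ} (hv0 : 0 < v) (hv : ∀ a ∈ top, v ≤ w a)
    {s : ℕ} (hs2 : 2 ≤ s) (hsn : s ≤ n) (hks : 4 * (top.card * s) ≤ n) {i : Fin n}
    (hi : i ∈ top) :
    1 / (2 * ((n : ℝ) / s + (∑ a ∈ topᶜ, w a) / v)) ≤ rate w s i := by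
  classical
  set W := (∑ a ∈ topᶜ, w a) / v with hW
  have hW0 : 0 ≤ W := div_nonneg (Finset.sum_nonneg fun a _ => (hw a).le) hv0.le
  set 𝒬 := Finset.powersetCard s (Finset.univ : Finset (Fin n))
  set 𝒬i := 𝒬.filter (fun Q => i ∈ Q) with h𝒬i
  obtain ⟨N, rfl⟩ : ∃ N, n = N + 2 := ⟨n - 2, by omega⟩
  obtain ⟨r, rfl⟩ : ∃ r, s = r + 2 := ⟨s - 2, by omega⟩
  set C : ℕ := (N + 1).choose (r + 1)
  set D : ℕ := N.choose r
  have hC : 𝒬i.card = C := by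
    have := Finset.card_filter_powersetCard_subset {i} (Finset.univ : Finset (Fin (N + 2)))
      (r + 2) (Finset.subset_univ _) (by simp)
    simpa [Finset.singleton_subset_iff] using this
  have hD : ∀ a, a ≠ i → ∑ Q ∈ 𝒬i, (if a ∈ Q then (1 : ℝ) else 0) = D := by
    intro a ha
    have := Finset.card_filter_powersetCard_subset {i, a} (Finset.univ : Finset (Fin (N + 2)))
      (r + 2) (Finset.subset_univ _) (by rw [Finset.card_pair ha.symm]; omega)
    rw [Finset.card_pair ha.symm] at this
    rw [Finset.sum_boole, h𝒬i, Finset.filter_filter]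
    simp only [Finset.insert_subset_iff, Finset.singleton_subset_iff] at this
    rw [this]
    simp [D]
  have hC0 : 0 < C := Nat.choose_pos (by omega)
  have hT0 : 0 < (N + 2).choose (r + 2) := Nat.choose_pos hsn
  have c1 : (N + 2) * C = (N + 2).choose (r + 2) * (r + 2) := Nat.add_one_mul_choose_eq (N + 1) (r + 1)
  have c2 : (N + 1) * D = C * (r + 1) := Nat.add_one_mul_choose_eq N r
  -- Given i ∈ Q, another label lies in Q with probability (s − 1)/(n − 1) ≤ s/n.
  have c3 : (N + 2) * D ≤ (r + 2) * C := by
    have : (N + 1) * ((N + 2) * D) ≤ (N + 1) * ((r + 2) * C) := by nlinarith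
    exact Nat.le_of_mul_le_mul_left this (by omega)
  set x0 : ℝ := W * ((r + 2 : ℕ) / (N + 2 : ℕ)) with hx0
  have hx00 : 0 ≤ x0 := by positivity
  have hDC : (D : ℝ) ≤ C * ((r + 2 : ℕ) / (N + 2 : ℕ)) := by
    rw [mul_div_assoc', le_div_iff₀ (by positivity)]
    exact_mod_cast (by linarith : D * (N + 2) ≤ C * (r + 2))
  set y : Finset (Fin (N + 2)) → ℝ := fun Q => ∑ a ∈ top.erase i, if a ∈ Q then 1 else 0 with hy
  set x : Finset (Fin (N + 2)) → ℝ := fun Q => ∑ a ∈ topᶜ, w a / v * if a ∈ Q then 1 else 0 with hx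
  have hsum : (C : ℝ) / (2 * (1 + x0)) ≤ ∑ Q ∈ 𝒬i, w i / ∑ a ∈ Q, w a := by
    calc (C : ℝ) / (2 * (1 + x0))
        ≤ ((1 + 2 * x0) * (C - ∑ Q ∈ 𝒬i, y Q) - ∑ Q ∈ 𝒬i, x Q) / (1 + x0) ^ 2 := by
          have hys : ∑ Q ∈ 𝒬i, y Q ≤ C / 4 := by
            rw [hy, Finset.sum_comm, Finset.sum_congr rfl
              fun a ha => hD a (Finset.ne_of_mem_erase ha), Finset.sum_const, nsmul_eq_mul]
            have k1 : 4 * ((top.erase i).card * D) ≤ C := by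
              have k2 : (top.erase i).card ≤ top.card := Finset.card_erase_le
              have k3 : (N + 2) * (4 * ((top.erase i).card * D)) ≤ (N + 2) * C := by
                calc (N + 2) * (4 * ((top.erase i).card * D))
                    = 4 * (top.erase i).card * ((N + 2) * D) := by ring
                  _ ≤ 4 * top.card * ((r + 2) * C) := by gcongr
                  _ = 4 * (top.card * (r + 2)) * C := by ring
                  _ ≤ (N + 2) * C := by gcongr
              exact Nat.le_of_mul_le_mul_left k3 (by omega)
            have k4 : (4 : ℝ) * ((top.erase i).card * D) ≤ C := by exact_mod_cast k1
            linarith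
          have hxs : ∑ Q ∈ 𝒬i, x Q ≤ C * x0 := by
            rw [hx, Finset.sum_comm]
            simp_rw [← Finset.mul_sum]
            rw [Finset.sum_congr rfl fun a ha => by
              rw [hD a (fun h => (Finset.mem_compl.1 ha) (h ▸ hi))], ← Finset.sum_mul,
              ← Finset.sum_div, ← hW, hx0]
            calc W * D ≤ W * (C * ((r + 2 : ℕ) / (N + 2 : ℕ))) := by gcongr
              _ = _ := by ring
          have hC0' : (0 : ℝ) < C := by exact_mod_cast hC0
          rw [div_le_div_iff₀ (by positivity) (by positivity)]
          -- Dividing by C: (1 + 2x0) · 3/4 − x0 = 3/4 + x0/2 ≥ (1 + x0)/2.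
          have k5 : (C : ℝ) * (1 + x0) / 2 ≤
              (1 + 2 * x0) * (C - ∑ Q ∈ 𝒬i, y Q) - ∑ Q ∈ 𝒬i, x Q := by nlinarith
          nlinarith [mul_le_mul_of_nonneg_right k5 (by positivity : (0 : ℝ) ≤ 2 * (1 + x0))]
      _ = ∑ Q ∈ 𝒬i, ((1 + 2 * x0) * (1 - y Q) - x Q) / (1 + x0) ^ 2 := by
          rw [← Finset.sum_div, Finset.sum_sub_distrib, ← Finset.mul_sum, Finset.sum_sub_distrib,
            Finset.sum_const, hC]
          simp
      _ ≤ _ := by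
          refine Finset.sum_le_sum fun Q hQ => ?_
          have hiQ : i ∈ Q := (Finset.mem_filter.1 hQ).2
          have hx0Q : 0 ≤ x Q := Finset.sum_nonneg fun a _ => by
            have := hw a
            split_ifs <;> positivity
          refine tangent_le (y := y Q) hx00 hx0Q (hw i) ?_ (Finset.sum_pos (fun a _ => hw a) ⟨i, hiQ⟩)
          by_cases hex : ∃ a ∈ top.erase i, a ∈ Q
          · right
            obtain ⟨a, ha, haQ⟩ := hex
            have : (if a ∈ Q then (1 : ℝ) else 0) ≤ y Q :=
              Finset.single_le_sum (f := fun a => if a ∈ Q then (1 : ℝ) else 0)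
                (fun b _ => by split_ifs <;> norm_num) ha
            rwa [if_pos haQ] at this
          · left
            push Not at hex
            refine ⟨Finset.sum_eq_zero fun a ha => if_neg (hex a ha), ?_⟩
            have e1 : ∑ a ∈ Q, w a = w i + ∑ a ∈ Q.erase i, w a :=
              (Finset.add_sum_erase Q w hiQ).symm
            have e2 : ∑ a ∈ Q.erase i, w a ≤ v * x Q := by
              rw [hx]
              simp only [mul_ite, mul_one, mul_zero]
              rw [← Finset.sum_filter, Finset.mul_sum]
              refine le_trans (Finset.sum_le_sum_of_subset_of_nonneg
                (t := topᶜ.filter (· ∈ Q)) ?_ fun a _ _ => (hw a).le) (le_of_eq ?_)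
              · intro a ha
                obtain ⟨hai, haQ⟩ := Finset.mem_erase.1 ha
                refine Finset.mem_filter.2 ⟨Finset.mem_compl.2 fun hat => ?_, haQ⟩
                exact hex a (Finset.mem_erase.2 ⟨hai, hat⟩) haQ
              · exact Finset.sum_congr rfl fun a _ => by field_simp
            rw [e1]
            nlinarith [mul_le_mul_of_nonneg_right (hv i hi) hx0Q]
  unfold rate
  rw [← Finset.sum_filter]
  refine le_trans (le_of_eq ?_) (div_le_div_of_nonneg_right hsum (Nat.cast_nonneg _))
  have c1' : ((N + 2 : ℕ) : ℝ) * C = ((N + 2).choose (r + 2) : ℕ) * (r + 2 : ℕ) := by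
    exact_mod_cast c1
  have hT0' : (0 : ℝ) < ((N + 2).choose (r + 2) : ℕ) := by exact_mod_cast hT0
  have hn0 : (0 : ℝ) < (N + 2 : ℕ) := by positivity
  have hr0 : (0 : ℝ) < (r + 2 : ℕ) := by positivity
  rw [div_div, div_eq_div_iff (by positivity) (by positivity), hx0]
  field_simp
  linear_combination -c1'

end Rate

end TopK
end
-- Failure probability of the counting phase
noncomputable section

variable {n : ℕ}

namespace TopK

open RoundAlgorithm

section Count

variable {k l s : ℕ} {w : Fin n → ℝ} (hw : ∀ a, 0 < w a)

/-- The law of the winner of a comparison of `s` labels chosen uniformly at random. -/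
def winLaw (h : (Finset.univ.filter fun q : Query n l => q.1.card = s).Nonempty) :
    PMF (Fin n) :=
  (PMF.uniformOfFinset _ h).bind fun q => mnlChoice w hw q.1 q.nonempty

theorem map_queries (hs : 2 ≤ s) (hsl : s ≤ l) :
    (Finset.univ.filter fun q : Query n l => q.1.card = s).map (Function.Embedding.subtype _) =
      Finset.powersetCard s (Finset.univ : Finset (Fin n)) := by
  ext Q
  simp only [Finset.mem_map, Finset.mem_filter, Finset.mem_univ, true_and,
    Finset.mem_powersetCard, Finset.subset_univ, Function.Embedding.subtype_apply]
  constructor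
  · rintro ⟨q, hq, rfl⟩; exact hq
  · intro h; exact ⟨⟨Q, by omega, by omega⟩, h, rfl⟩

theorem queries_nonempty (hs : 2 ≤ s) (hsl : s ≤ l) (hsn : s ≤ n) :
    (Finset.univ.filter fun q : Query n l => q.1.card = s).Nonempty := by
  rw [← Finset.map_nonempty (f := Function.Embedding.subtype _), map_queries hs hsl,
    Finset.powersetCard_nonempty]
  simpa using hsn

theorem winLaw_apply (hs : 2 ≤ s) (hsl : s ≤ l)
    (h : (Finset.univ.filter fun q : Query n l => q.1.card = s).Nonempty) (i : Fin n) :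
    winLaw hw h i = ENNReal.ofReal (rate w s i) := by
  have hcard : (Finset.univ.filter fun q : Query n l => q.1.card = s).card = n.choose s := by
    rw [← Finset.card_map (Function.Embedding.subtype _), map_queries hs hsl]
    simp
  have hpos : 0 < n.choose s := by rw [← hcard]; exact h.card_pos
  have e : winLaw hw h i = (PMF.uniformOfFinset _ h).expect
      fun q => mnlChoice w hw q.1 q.nonempty i := PMF.bind_apply _ _ _
  have hnn : ∀ Q : Finset (Fin n), 0 ≤ if i ∈ Q then w i / ∑ a ∈ Q, w a else 0 := by
    intro Q
    split_ifs
    · exact div_nonneg (hw i).le (Finset.sum_nonneg fun a _ => (hw a).le)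
    · exact le_rfl
  rw [e, PMF.expect_uniformOfFinset, hcard, rate, ← map_queries hs hsl, Finset.sum_map,
    ENNReal.ofReal_div_of_pos (by exact_mod_cast hpos), ENNReal.ofReal_natCast,
    ENNReal.ofReal_sum_of_nonneg fun q _ => hnn _, mul_comm, ← div_eq_mul_inv]
  congr 1
  refine Finset.sum_congr rfl fun q _ => ?_
  rw [mnlChoice, PMF.ofFinset_apply, Function.Embedding.subtype_apply]
  split_ifs <;> simp

/-- The supermartingale property behind `overtake`: a win of i kills it and a win of j doubles it,
so the mean factor is 1 − rate i + rate j ≤ 1. -/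
theorem expect_winLaw_loss_le (hs : 2 ≤ s) (hsl : s ≤ l)
    (h : (Finset.univ.filter fun q : Query n l => q.1.card = s).Nonempty) {i j : Fin n}
    (hij : w j ≤ w i) :
    (winLaw hw h).expect (fun a => (if a = i then 0 else 1) + (if a = j then 1 else 0)) ≤ 1 := by
  rw [PMF.expect_add, PMF.expect_ite_eq]
  refine (add_le_add le_rfl ?_).trans_eq (PMF.expect_ite_ne_add_apply (winLaw hw h) i)
  rw [winLaw_apply hw hs hsl, winLaw_apply hw hs hsl]
  exact ENNReal.ofReal_le_ofReal (rate_le_rate hw s hij)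

theorem expect_winLaw_half_le (hs : 2 ≤ s) (hsl : s ≤ l)
    (h : (Finset.univ.filter fun q : Query n l => q.1.card = s).Nonempty) {i : Fin n} {ρ : ℝ}
    (hρ : ρ ≤ rate w s i) :
    (winLaw hw h).expect (fun a => if a = i then 2⁻¹ else 1) ≤ ENNReal.ofReal (1 - ρ / 2) := by
  have h0 := rate_nonneg hw s i
  have h1 := PMF.expect_ite_ne_add_apply (winLaw hw h) i
  have h2 : rate w s i ≤ 1 := by
    have := (le_add_self.trans h1.le : winLaw hw h i ≤ 1)
    rwa [winLaw_apply hw hs hsl, ENNReal.ofReal_le_one] at this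
  have e : (fun a : Fin n => if a = i then (2⁻¹ : ℝ≥0∞) else 1) =
      fun a => (if a = i then 0 else 1) + 2⁻¹ * if a = i then 1 else 0 := by
    funext a; split_ifs <;> simp
  have h3 : (winLaw hw h).expect (fun b => if b = i then 0 else 1) =
      ENNReal.ofReal (1 - rate w s i) := by
    rw [ENNReal.ofReal_sub _ h0, ENNReal.ofReal_one, ← winLaw_apply hw hs hsl h i]
    refine ENNReal.eq_sub_of_add_eq ?_ h1
    exact ne_top_of_le_ne_top ENNReal.one_ne_top (le_add_self.trans h1.le)
  have h4 : (2⁻¹ : ℝ≥0∞) = ENNReal.ofReal (1 / 2) := by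
    rw [one_div, ENNReal.ofReal_inv_of_pos (by norm_num)]; simp
  rw [e, PMF.expect_add, PMF.expect_mul_left, PMF.expect_ite_eq, h3, winLaw_apply hw hs hsl, h4,
    ← ENNReal.ofReal_mul (by norm_num), ← ENNReal.ofReal_add (by linarith) (by linarith)]
  exact ENNReal.ofReal_le_ofReal (by linarith)

/-- Bounds the probability that `j` reaches `m` wins before `i` wins for the first time. -/
def overtake (m : ℕ) (c : Fin n → ℕ) (i j : Fin n) : ℝ≥0∞ :=
  (if c i = 0 then 2 ^ c j else 0) * 2⁻¹ ^ m

/-- Bounds the probability that `i` does not soon reach `m` wins. -/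
def shortage (m : ℕ) (c : Fin n → ℕ) (i : Fin n) : ℝ≥0∞ := 2 ^ m * 2⁻¹ ^ c i

/-- The win counts after a further win of `a`. -/
def addWin (c : Fin n → ℕ) (a b : Fin n) : ℕ := c b + [a].count b

theorem addWin_self (c : Fin n → ℕ) (a : Fin n) : addWin c a a = c a + 1 := by simp [addWin]

theorem addWin_of_ne (c : Fin n → ℕ) {a b : Fin n} (h : a ≠ b) : addWin c a b = c b := by
  simp [addWin, h]

theorem overtake_addWin_le (m : ℕ) (c : Fin n → ℕ) {i j : Fin n} (a : Fin n) :
    overtake m (addWin c a) i j ≤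
      overtake m c i j * ((if a = i then 0 else 1) + if a = j then 1 else 0) := by
  unfold overtake
  by_cases hi : a = i
  · subst hi
    rw [addWin_self, if_neg (by omega), zero_mul]
    exact zero_le
  · rw [addWin_of_ne c hi, if_neg hi]
    by_cases hj : a = j
    · subst hj
      rw [addWin_self, if_pos rfl]
      split_ifs
      · rw [pow_succ]; exact le_of_eq (by ring)
      · simp
    · rw [addWin_of_ne c hj, if_neg hj, add_zero, mul_one]

theorem shortage_addWin (m : ℕ) (c : Fin n → ℕ) (i a : Fin n) :
    shortage m (addWin c a) i = shortage m c i * if a = i then 2⁻¹ else 1 := by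
  unfold shortage
  split_ifs with h
  · subst h; rw [addWin_self, pow_succ, mul_assoc]
  · rw [addWin_of_ne c h, mul_one]

variable {P : Params} {top : Finset (Fin n)}

/-- If some top item has no win, then by pigeonhole one of the k labels that reached the goal lies
outside the top, and the corresponding `overtake` term is at least 1. -/
theorem fail_afterCount_of_reached (hk : top.card = k) (hm : P.wins ≠ 0) {S B N : ℕ} {δ : ℝ≥0∞}
    (hδ : ∀ (A : Finset (Fin n)) (N : ℕ), top ⊆ A → A.card ≤ S → B ≤ N →
      (algorithm n k l P).fail w hw top N (.refine 0 A ∅) ≤ δ) (hN : B ≤ N) (c : Fin n → ℕ)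
    (hS : (Finset.univ.filter fun a => 1 ≤ c a).card ≤ S)
    (hc : k ≤ (Finset.univ.filter fun a => P.wins ≤ c a).card) :
    (algorithm n k l P).fail w hw top N (afterCount k P c) ≤
      ∑ i ∈ top, ∑ j ∈ topᶜ, overtake P.wins c i j + δ := by
  rw [afterCount, if_pos hc]
  by_cases htop : top ⊆ Finset.univ.filter fun a => 1 ≤ c a
  · exact (hδ _ N htop hS hN).trans le_add_self
  refine (RoundAlgorithm.fail_le_one _ _ _ _ _ _).trans (le_trans ?_ le_self_add)
  rw [Finset.not_subset] at htop
  obtain ⟨i, hi, hic⟩ := htop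
  have hci : c i = 0 := by
    simp at hic
    omega
  obtain ⟨j, hj, hcj⟩ : ∃ j ∈ topᶜ, P.wins ≤ c j := by
    by_contra! hcon
    have hsub : (Finset.univ.filter fun a => P.wins ≤ c a) ⊆ top.erase i := by
      intro a ha
      have ha' := (Finset.mem_filter.1 ha).2
      refine Finset.mem_erase.2 ⟨fun h => ?_, ?_⟩
      · rw [h, hci] at ha'; omega
      · by_contra hat
        exact absurd ha' (not_le.2 (hcon a (Finset.mem_compl.2 hat)))
    have h1 := Finset.card_le_card hsub
    have h2 := Finset.card_erase_add_one hi
    omega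
  refine le_trans ?_ (Finset.single_le_sum
    (f := fun i => ∑ j ∈ topᶜ, overtake P.wins c i j) (fun _ _ => zero_le) hi)
  refine le_trans ?_ (Finset.single_le_sum
    (f := fun j => overtake P.wins c i j) (fun _ _ => zero_le) hj)
  simp only [overtake, if_pos hci]
  calc (1 : ℝ≥0∞) = 2 ^ P.wins * 2⁻¹ ^ P.wins := by
        rw [← mul_pow, ENNReal.mul_inv_cancel (by simp) (by simp), one_pow]
    _ ≤ _ := by gcongr; norm_num

/-- Induction on the number d of comparisons still allowed. With d = 0 some top item is short of
wins and its `shortage` is at least 1. Each comparison creates at most one new candidate, which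
keeps their number at most S. -/
theorem fail_count (hk : top.card = k) (hm : P.wins ≠ 0)
    (hsep : ∀ a ∈ top, ∀ b ∉ top, w b < w a) (hs : 2 ≤ P.size) (hsl : P.size ≤ l)
    (hsn : P.size ≤ n) {ρ : ℝ} (hρ : ∀ i ∈ top, ρ ≤ rate w P.size i) {S B : ℕ} {δ : ℝ≥0∞}
    (hδ : ∀ (A : Finset (Fin n)) (N : ℕ), top ⊆ A → A.card ≤ S → B ≤ N →
      (algorithm n k l P).fail w hw top N (.refine 0 A ∅) ≤ δ) (d : ℕ) :
    ∀ (N : ℕ) (c : Fin n → ℕ), (Finset.univ.filter fun a => 1 ≤ c a).card + d ≤ S → d + B ≤ N →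
      (Finset.univ.filter fun a => P.wins ≤ c a).card < k →
      (algorithm n k l P).fail w hw top N (.count c) ≤
        ∑ i ∈ top, ∑ j ∈ topᶜ, overtake P.wins c i j +
          ∑ i ∈ top, shortage P.wins c i * ENNReal.ofReal (1 - ρ / 2) ^ d + δ := by
  induction d with
  | zero =>
    intro N c _ _ hc
    refine (RoundAlgorithm.fail_le_one _ _ _ _ _ _).trans
      (le_trans ?_ (le_self_add.trans' le_add_self))
    obtain ⟨i, hi, hci⟩ : ∃ i ∈ top, c i < P.wins := by
      by_contra! hcon
      have : top ⊆ Finset.univ.filter fun a => P.wins ≤ c a := fun a ha =>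
        Finset.mem_filter.2 ⟨Finset.mem_univ _, hcon a ha⟩
      have := Finset.card_le_card this
      omega
    refine le_trans ?_ (Finset.single_le_sum (fun _ _ => zero_le) hi)
    rw [pow_zero, mul_one, shortage]
    calc (1 : ℝ≥0∞) = 2 ^ c i * 2⁻¹ ^ c i := by
          rw [← mul_pow, ENNReal.mul_inv_cancel (by simp) (by simp), one_pow]
      _ ≤ _ := by gcongr; norm_num
  | succ d ih =>
    intro N c hcS hN hc
    have hq := queries_nonempty (n := n) hs hsl hsn
    have hplan : (algorithm n k l P).plan (.count c) =
        Sum.inl ((PMF.uniformOfFinset _ hq).map fun q =>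
          ([q], fun as => afterCount k P fun a => c a + as.count a)) := by
      change plan k l P (.count c) = _
      rw [plan, dif_pos hq]
    rw [RoundAlgorithm.fail_step _ _ _ hplan, PMF.expect_map]
    swap
    · intro x hx
      obtain ⟨q, _, rfl⟩ := (PMF.mem_support_map_iff _ _ _).1 hx
      refine ⟨by simp, ?_⟩
      simp only [List.length_singleton]
      omega
    have e : ((PMF.uniformOfFinset _ hq).expect fun q => (draw w hw [q]).expect fun as =>
        (algorithm n k l P).fail w hw top (N - [q].length)
          (afterCount k P fun a => c a + as.count a)) =
        (winLaw hw hq).expect fun a =>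
          (algorithm n k l P).fail w hw top (N - 1) (afterCount k P (addWin c a)) := by
      rw [winLaw, PMF.expect_bind]
      simp only [draw, PMF.expect_bind, PMF.expect_map, PMF.expect_pure, List.length_singleton]
      rfl
    refine e.le.trans ?_
    set q := ENNReal.ofReal (1 - ρ / 2)
    calc _ ≤ (winLaw hw hq).expect fun a =>
          ∑ i ∈ top, ∑ j ∈ topᶜ, overtake P.wins (addWin c a) i j +
            ∑ i ∈ top, shortage P.wins (addWin c a) i * q ^ d + δ := by
          refine PMF.expect_mono _ fun a _ => ?_
          have hS : (Finset.univ.filter fun b => 1 ≤ addWin c a b).card ≤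
              (Finset.univ.filter fun b => 1 ≤ c b).card + 1 := by
            refine (Finset.card_le_card (t := insert a _) fun b hb => ?_).trans
              (Finset.card_insert_le a _)
            by_cases hab : a = b
            · rw [hab]; exact Finset.mem_insert_self _ _
            · have := (Finset.mem_filter.1 hb).2
              rw [addWin_of_ne c hab] at this
              exact Finset.mem_insert_of_mem (Finset.mem_filter.2 ⟨Finset.mem_univ _, this⟩)
          by_cases hdone : k ≤ (Finset.univ.filter fun b => P.wins ≤ addWin c a b).card
          · refine (fail_afterCount_of_reached hw hk hm hδ (by omega) _ (by omega) hdone).trans ?_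
            gcongr
            exact le_self_add
          · rw [afterCount, if_neg hdone]
            exact ih (N - 1) _ (by omega) (by omega) (by omega)
      _ ≤ _ := by
          simp only [PMF.expect_add, PMF.expect_const, PMF.expect_finset_sum]
          gcongr with i hi j hj i hi
          · calc _ ≤ (winLaw hw hq).expect fun a => overtake P.wins c i j *
                  ((if a = i then 0 else 1) + if a = j then 1 else 0) :=
                  PMF.expect_mono _ fun a _ => overtake_addWin_le _ _ _
              _ ≤ _ := by
                  rw [PMF.expect_mul_left]
                  exact mul_le_of_le_one_right' (expect_winLaw_loss_le hw hs hsl hq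
                    (hsep i hi j (Finset.mem_compl.1 hj)).le)
          · simp only [shortage_addWin]
            rw [PMF.expect_mul_right, PMF.expect_mul_left, pow_succ', ← mul_assoc]
            gcongr
            exact expect_winLaw_half_le hw hs hsl hq (hρ i hi)

end Count

end TopK
end
-- Choice of the parameters and the comparison budget
noncomputable section

variable {n : ℕ}

namespace TopK

/-- The parameters for failure probability `1 / n ^ c`. -/
def params (c n k l : ℕ) : Params where
  size := min l (n / (4 * k))
  wins := (c + 4) * Nat.clog 2 n
  coarse := 3 * ((c + 4) * Nat.clog 2 n)
  conf := (c + 4) * Nat.clog 2 n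

theorem natCast_pow_mul_half_pow_le (c n : ℕ) :
    (n : ℝ≥0∞) ^ c * 2⁻¹ ^ (c * Nat.clog 2 n) ≤ 1 := by
  have h : (n : ℝ≥0∞) ≤ 2 ^ Nat.clog 2 n := by
    exact_mod_cast Nat.le_pow_clog (by norm_num) n
  calc (n : ℝ≥0∞) ^ c * 2⁻¹ ^ (c * Nat.clog 2 n)
      ≤ (2 ^ Nat.clog 2 n) ^ c * 2⁻¹ ^ (c * Nat.clog 2 n) := by gcongr
    _ = 1 := by
      rw [← pow_mul, mul_comm (Nat.clog 2 n) c, ← mul_pow,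
        ENNReal.mul_inv_cancel (by simp) (by simp), one_pow]

/-- (3/4)³ = 27/64 < 1/2; hence three times as many coarse rounds as halvings needed. -/
theorem three_quarters_pow_le (a : ℕ) : ENNReal.ofReal (3 / 4) ^ (3 * a) ≤ 2⁻¹ ^ a := by
  rw [pow_mul]
  refine pow_le_pow_left' ?_ a
  rw [← ENNReal.ofReal_pow (by norm_num), show (2⁻¹ : ℝ≥0∞) = ENNReal.ofReal (1 / 2) by
    rw [one_div, ENNReal.ofReal_inv_of_pos (by norm_num)]; simp]
  exact ENNReal.ofReal_le_ofReal (by norm_num)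

/-- 1 − ρ/2 ≤ exp(−ρ/2) and ρd ≥ 4a give the factor exp(−2a) ≤ 2^(−2a). -/
theorem two_pow_mul_pow_le {ρ : ℝ} (hρ : 0 < ρ) (a d : ℕ) (hd : 4 * a / ρ ≤ d) :
    (2 : ℝ≥0∞) ^ a * ENNReal.ofReal (1 - ρ / 2) ^ d ≤ 2⁻¹ ^ a := by
  have h2 : Real.exp (-1) ≤ 1 / 2 := by
    rw [Real.exp_neg, one_div]
    exact inv_anti₀ (by norm_num) (by have := Real.add_one_le_exp 1; linarith)
  have h1 : ENNReal.ofReal (1 - ρ / 2) ^ d ≤ 2⁻¹ ^ (2 * a) := by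
    calc ENNReal.ofReal (1 - ρ / 2) ^ d ≤ ENNReal.ofReal (Real.exp (-(ρ / 2))) ^ d := by
          gcongr
          have := Real.add_one_le_exp (-(ρ / 2))
          linarith
      _ = ENNReal.ofReal (Real.exp (-(ρ * d / 2))) := by
          rw [← ENNReal.ofReal_pow (Real.exp_pos _).le, ← Real.exp_nat_mul]
          ring_nf
      _ ≤ ENNReal.ofReal ((1 / 2) ^ (2 * a)) := by
          refine ENNReal.ofReal_le_ofReal ?_
          calc Real.exp (-(ρ * d / 2)) ≤ Real.exp ((2 * a : ℕ) * (-1)) := by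
                rw [Real.exp_le_exp]
                rw [div_le_iff₀ hρ] at hd
                push_cast
                linarith
            _ = Real.exp (-1) ^ (2 * a) := Real.exp_nat_mul _ _
            _ ≤ _ := pow_le_pow_left₀ (Real.exp_pos _).le h2 _
      _ = _ := by
          rw [ENNReal.ofReal_pow (by norm_num), one_div, ENNReal.ofReal_inv_of_pos (by norm_num)]
          simp
  calc (2 : ℝ≥0∞) ^ a * ENNReal.ofReal (1 - ρ / 2) ^ d ≤ 2 ^ a * 2⁻¹ ^ (2 * a) := by gcongr
    _ = _ := by
      rw [two_mul, pow_add, ← mul_assoc, ← mul_pow, ENNReal.mul_inv_cancel (by simp) (by simp),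
        one_pow, one_mul]

theorem natCast_clog_le {n : ℕ} (hn : 2 ≤ n) : (Nat.clog 2 n : ℝ) ≤ 4 * Real.log n := by
  have hn0 : (0 : ℝ) < n := by positivity
  have hl2 : (1 : ℝ) / 2 < Real.log 2 := by linarith [Real.log_two_gt_d9]
  have hln : Real.log 2 ≤ Real.log n := Real.log_le_log (by norm_num) (by exact_mod_cast hn)
  have h1 : 2 ^ (Nat.clog 2 n - 1) < n := Nat.pow_pred_clog_lt_self (by norm_num) (by omega)
  have h0 : 0 < Nat.clog 2 n := Nat.clog_pos (by norm_num) hn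
  have h2 : ((Nat.clog 2 n - 1 : ℕ) : ℝ) * Real.log 2 ≤ Real.log n := by
    rw [← Real.log_pow]
    exact Real.log_le_log (by positivity) (by exact_mod_cast h1.le)
  rw [Nat.cast_sub h0] at h2
  have h3 : (0 : ℝ) ≤ (Nat.clog 2 n : ℝ) - 1 := by
    have : (1 : ℝ) ≤ Nat.clog 2 n := by exact_mod_cast h0
    linarith
  push_cast at h2
  nlinarith

theorem exists_pow_gap {x : ℝ} (hx : 1 ≤ x) :
    ∃ R : ℕ, 3 * (1 / 2 : ℝ) ^ R < x⁻¹ ∧ (R : ℝ) ≤ 2 * Real.log x + 3 := by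
  have hx0 : 0 < x := by linarith
  have hl2 : (1 : ℝ) / 2 < Real.log 2 := by linarith [Real.log_two_gt_d9]
  have hlx : 0 ≤ Real.log x := Real.log_nonneg hx
  have hlog : 0 ≤ Real.logb 2 x := Real.logb_nonneg (by norm_num) hx
  -- The summand 2 absorbs the factor 3 < 2².
  refine ⟨⌈Real.logb 2 x⌉₊ + 2, ?_, ?_⟩
  · have h1 : x ≤ 2 ^ ⌈Real.logb 2 x⌉₊ := by
      rw [← Real.rpow_natCast, ← Real.logb_le_iff_le_rpow (by norm_num) hx0]
      exact Nat.le_ceil _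
    rw [one_div, inv_pow, ← div_eq_mul_inv, ← one_div, div_lt_div_iff₀ (by positivity) hx0,
      pow_add]
    linarith
  · have h2 := (Nat.ceil_lt_add_one hlog).le
    have h3 : Real.logb 2 x ≤ 2 * Real.log x := by
      rw [Real.logb, div_le_iff₀ (by linarith)]
      nlinarith
    push_cast
    linarith

section Main

variable {k l c : ℕ} {w : Fin n → ℝ} (hw : ∀ a, 0 < w a) {top : Finset (Fin n)} {u v : ℝ}

/-- Each candidate's inverse squared relative gap is a summand on the right and is at least 4^r/9.
-/
theorem card_mul_four_pow_le (hu : ∀ a ∉ top, w a ≤ u) (huv : u < v) (hu0 : 0 < u)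
    (hv : ∀ a ∈ top, v ≤ w a) {A : Finset (Fin n)} (hA : far w top u v A = ∅) {r : ℕ}
    (hgap : ∀ i ∈ A, relGap w top u v i ≤ 3 * (1 / 2) ^ r) :
    (A.card : ℝ) * 4 ^ r ≤
      9 * (∑ a ∈ topᶜ.filter (fun a => v / 2 ≤ w a), v ^ 2 / (v - w a) ^ 2 +
        ∑ a ∈ top.filter (fun a => w a ≤ 2 * u), u ^ 2 / (u - w a) ^ 2) := by
  classical
  have near : ∀ a ∈ A, (a ∈ top → w a ≤ 2 * u) ∧ (a ∉ top → v / 2 ≤ w a) := by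
    intro a ha
    have : a ∉ far w top u v A := by rw [hA]; exact Finset.notMem_empty _
    constructor
    · intro h; by_contra! h'; exact this (Finset.mem_filter.2 ⟨ha, Or.inl ⟨h, h'⟩⟩)
    · intro h; by_contra! h'; exact this (Finset.mem_filter.2 ⟨ha, Or.inr ⟨h, h'⟩⟩)
  have key : ∀ x y : ℝ, 0 < x → 0 < y → y / x ≤ 3 * (1 / 2) ^ r → (4 : ℝ) ^ r ≤ 9 * (x ^ 2 / y ^ 2) := by
    intro x y hx hy h
    have h1 : ((1 : ℝ) / 2) ^ r * 2 ^ r = 1 := by rw [← mul_pow]; norm_num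
    rw [div_le_iff₀ hx] at h
    have h2 : y * 2 ^ r ≤ 3 * x := by
      calc y * 2 ^ r ≤ 3 * (1 / 2) ^ r * x * 2 ^ r := by gcongr
        _ = 3 * x * ((1 / 2) ^ r * 2 ^ r) := by ring
        _ = 3 * x := by rw [h1, mul_one]
    have h3 := pow_le_pow_left₀ (by positivity) h2 2
    rw [mul_div_assoc', le_div_iff₀ (by positivity), show (4 : ℝ) = 2 ^ 2 by norm_num, ← pow_mul,
      mul_comm 2 r, pow_mul]
    linarith
  have hv0 : 0 < v := hu0.trans huv
  have hb : ∑ a ∈ A.filter (· ∉ top), (4 : ℝ) ^ r ≤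
      ∑ a ∈ topᶜ.filter (fun a => v / 2 ≤ w a), 9 * (v ^ 2 / (v - w a) ^ 2) := by
    refine (Finset.sum_le_sum fun a ha => ?_).trans
      (Finset.sum_le_sum_of_subset_of_nonneg ?_ fun a _ _ => by positivity)
    · obtain ⟨haA, hat⟩ := Finset.mem_filter.1 ha
      have h1 := hgap a haA
      rw [relGap, if_neg hat] at h1
      exact key v (v - w a) hv0 (by linarith [hu a hat]) h1
    · intro a ha
      obtain ⟨haA, hat⟩ := Finset.mem_filter.1 ha
      exact Finset.mem_filter.2 ⟨Finset.mem_compl.2 hat, (near a haA).2 hat⟩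
  have ht : ∑ a ∈ A.filter (· ∈ top), (4 : ℝ) ^ r ≤
      ∑ a ∈ top.filter (fun a => w a ≤ 2 * u), 9 * (u ^ 2 / (u - w a) ^ 2) := by
    refine (Finset.sum_le_sum fun a ha => ?_).trans
      (Finset.sum_le_sum_of_subset_of_nonneg ?_ fun a _ _ => by positivity)
    · obtain ⟨haA, hat⟩ := Finset.mem_filter.1 ha
      have h1 := hgap a haA
      rw [relGap, if_pos hat] at h1
      have h2 := key u (w a - u) hu0 (by linarith [hv a hat]) h1
      rwa [show (w a - u) ^ 2 = (u - w a) ^ 2 by ring] at h2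
    · intro a ha
      obtain ⟨haA, hat⟩ := Finset.mem_filter.1 ha
      exact Finset.mem_filter.2 ⟨hat, (near a haA).1 hat⟩
  rw [← Finset.mul_sum] at hb ht
  rw [← nsmul_eq_mul, ← Finset.sum_const,
    ← Finset.sum_filter_add_sum_filter_not A (· ∈ top)]
  linarith

theorem fail_refine_start (hl : 2 ≤ l) (hk : top.card = k) (hu : ∀ a ∉ top, w a ≤ u)
    (huv : u < v) (hu0 : 0 < u) (hv : ∀ a ∈ top, v ≤ w a) {R B S : ℕ}
    (hR : 3 * (1 / 2 : ℝ) ^ R < (v - u) / v)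
    (hB : 2 ^ 14 * ((4 * ((c + 4) * Nat.clog 2 n) + R + 2 : ℕ) : ℝ) *
      (9 * (∑ a ∈ topᶜ.filter (fun a => v / 2 ≤ w a), v ^ 2 / (v - w a) ^ 2 +
        ∑ a ∈ top.filter (fun a => w a ≤ 2 * u), u ^ 2 / (u - w a) ^ 2)) ≤ B)
    {A : Finset (Fin n)} {N : ℕ} (htop : top ⊆ A) (hA : A.card ≤ S)
    (hN : 3 * ((c + 4) * Nat.clog 2 n) *
      (S * (2 ^ 14 * (4 * ((c + 4) * Nat.clog 2 n) + 2))) + R * B ≤ N) :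
    (algorithm n k l (params c n k l)).fail w hw top N (.refine 0 A ∅) ≤
      2 * (n * 2⁻¹ ^ ((c + 4) * Nat.clog 2 n)) := by
  set a := (c + 4) * Nat.clog 2 n with ha
  have hcoarse : (params c n k l).coarse = 3 * a := rfl
  have hconf : (params c n k l).conf = a := rfl
  refine (fail_refine_coarse (S := S) (B := B) hw hl hk hu huv hu0 hv hR ?_ (3 * a) 0 N A ∅
    (by rw [hcoarse, zero_add]) ⟨?_, Finset.disjoint_empty_left _⟩ hA ?_).trans ?_
  · intro r A' hr hfar hgap
    have h1 := card_mul_four_pow_le hu huv hu0 hv hfar hgap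
    have h2 : (A'.card * (params c n k l).samples ((params c n k l).coarse + r) : ℝ) ≤ B := by
      refine le_trans ?_ hB
      rw [Params.samples, hcoarse, hconf, Nat.add_sub_cancel_left]
      calc ((A'.card : ℝ) * ((2 ^ 14 * 4 ^ r * (a + (3 * a + r) + 2) : ℕ) : ℝ))
          = 2 ^ 14 * ((4 * a + r + 2 : ℕ) : ℝ) * (A'.card * 4 ^ r) := by push_cast; ring
        _ ≤ _ := by gcongr
    exact_mod_cast h2
  · rw [Finset.empty_union, Finset.inter_eq_right.2 htop]
  · rw [Params.samples, hcoarse, hconf, Nat.sub_self, pow_zero, mul_one,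
      show a + 3 * a + 2 = 4 * a + 2 by ring]
    exact hN
  · rw [two_mul, tailBound, hconf, add_zero]
    refine add_le_add (mul_le_mul' ?_ (three_quarters_pow_le a)) le_rfl
    exact_mod_cast (Finset.card_le_univ _).trans_eq (Fintype.card_fin n)

/-- Explains c + 4: two powers of n for the union bound over pairs, two for 4 ≤ n², and c for the
target. -/
theorem four_mul_sq_mul_half_pow_le {n : ℕ} (hn : 2 ≤ n) (c : ℕ) :
    4 * ((n : ℝ≥0∞) ^ 2 * 2⁻¹ ^ ((c + 4) * Nat.clog 2 n)) ≤ ((n : ℝ≥0∞) ^ c)⁻¹ := by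
  have hn' : (2 : ℝ≥0∞) ≤ n := by exact_mod_cast hn
  rw [ENNReal.le_inv_iff_mul_le]
  calc 4 * ((n : ℝ≥0∞) ^ 2 * 2⁻¹ ^ ((c + 4) * Nat.clog 2 n)) * (n : ℝ≥0∞) ^ c
      = 2 ^ 2 * (n : ℝ≥0∞) ^ (c + 2) * 2⁻¹ ^ ((c + 4) * Nat.clog 2 n) := by ring
    _ ≤ (n : ℝ≥0∞) ^ 2 * (n : ℝ≥0∞) ^ (c + 2) * 2⁻¹ ^ ((c + 4) * Nat.clog 2 n) := by gcongr
    _ = (n : ℝ≥0∞) ^ (c + 4) * 2⁻¹ ^ ((c + 4) * Nat.clog 2 n) := by rw [← pow_add]; ring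
    _ ≤ 1 := natCast_pow_mul_half_pow_le _ _

theorem fail_start_le (hn : 2 ≤ n) (hk1 : 1 ≤ k) (hl : 2 ≤ l) (hk : top.card = k)
    (hu : ∀ a ∉ top, w a ≤ u) (huv : u < v) (hu0 : 0 < u) (hv : ∀ a ∈ top, v ≤ w a)
    {R B S N : ℕ} (hR : 3 * (1 / 2 : ℝ) ^ R < (v - u) / v)
    (hB : 2 ^ 14 * ((4 * ((c + 4) * Nat.clog 2 n) + R + 2 : ℕ) : ℝ) *
      (9 * (∑ a ∈ topᶜ.filter (fun a => v / 2 ≤ w a), v ^ 2 / (v - w a) ^ 2 +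
        ∑ a ∈ top.filter (fun a => w a ≤ 2 * u), u ^ 2 / (u - w a) ^ 2)) ≤ B)
    (hS : 64 * ((c + 4) * Nat.clog 2 n : ℕ) *
      ((n : ℝ) / l + k + (∑ a ∈ topᶜ, w a) / v) ≤ S)
    (hN : S + (3 * ((c + 4) * Nat.clog 2 n) *
      (S * (2 ^ 14 * (4 * ((c + 4) * Nat.clog 2 n) + 2))) + R * B) ≤ N) :
    (algorithm n k l (params c n k l)).fail w hw top N (algorithm n k l (params c n k l)).start ≤
      ((n : ℝ≥0∞) ^ c)⁻¹ := by
  set a := (c + 4) * Nat.clog 2 n with ha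
  set B2 := 3 * a * (S * (2 ^ 14 * (4 * a + 2))) + R * B with hB2
  set W := (∑ a ∈ topᶜ, w a) / v with hW
  have hv0 : 0 < v := hu0.trans huv
  have hW0 : 0 ≤ W := div_nonneg (Finset.sum_nonneg fun a _ => (hw a).le) hv0.le
  have hl0 : (0 : ℝ) < l := by positivity
  have hlam : 0 < Nat.clog 2 n := Nat.clog_pos (by norm_num) hn
  have ha0 : 0 < a := by positivity
  have ha1 : (1 : ℝ) ≤ (a : ℕ) := by exact_mod_cast ha0
  have hk1' : (1 : ℝ) ≤ k := by exact_mod_cast hk1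
  have hδ : ∀ (A : Finset (Fin n)) (N : ℕ), top ⊆ A → A.card ≤ S → B2 ≤ N →
      (algorithm n k l (params c n k l)).fail w hw top N (.refine 0 A ∅) ≤ 2 * (n * 2⁻¹ ^ a) :=
    fun A N h1 h2 h3 => fail_refine_start hw hl hk hu huv hu0 hv hR hB h1 h2 h3
  have hn1 : (1 : ℝ≥0∞) ≤ n := by exact_mod_cast (by omega : 1 ≤ n)
  have hsmall : (n : ℝ≥0∞) * 2⁻¹ ^ a ≤ (n : ℝ≥0∞) ^ 2 * 2⁻¹ ^ a := by
    gcongr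
    exact le_self_pow hn1 (by norm_num)
  refine le_trans ?_ (four_mul_sq_mul_half_pow_le hn c)
  have hstart : (algorithm n k l (params c n k l)).start =
      if 8 * k ≤ n then Phase.count 0 else Phase.refine 0 Finset.univ ∅ := rfl
  rw [hstart]
  split_ifs with hcase
  · have hq2 : 2 ≤ n / (4 * k) := by
      rw [Nat.le_div_iff_mul_le (by positivity)]; omega
    set s := min l (n / (4 * k)) with hs
    have hs2 : 2 ≤ s := le_min hl hq2
    have hs4 : 4 * (k * s) ≤ n := by
      calc 4 * (k * s) = s * (4 * k) := by ring
        _ ≤ n / (4 * k) * (4 * k) := Nat.mul_le_mul_right _ (min_le_right _ _)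
        _ ≤ n := Nat.div_mul_le_self _ _
    have hsn : s ≤ n := by nlinarith
    have hs0 : (0 : ℝ) < s := by positivity
    set ρ : ℝ := 1 / (2 * ((n : ℝ) / s + W)) with hρ
    have hn0 : (0 : ℝ) < n := by positivity
    have hρ0 : 0 < ρ := by positivity
    -- Rounding n/(4k) down costs at most a factor two, because the quotient is at least 1.
    have hns : (n : ℝ) / s ≤ n / l + 8 * k := by
      rcases min_choice l (n / (4 * k)) with h | h
      · rw [hs, h]; linarith
      · have h1 : n < (n / (4 * k) + 1) * (4 * k) := Nat.lt_mul_of_div_lt (by omega) (by positivity)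
        have h2 : n ≤ 8 * k * s := by rw [hs, h]; nlinarith
        have h3 : (n : ℝ) ≤ 8 * k * s := by exact_mod_cast h2
        have h4 : (n : ℝ) / s ≤ 8 * k := by rwa [div_le_iff₀ hs0]
        have : (0 : ℝ) ≤ n / l := by positivity
        linarith
    have hd : 4 * (a : ℝ) / ρ ≤ S := by
      refine le_trans ?_ hS
      rw [hρ, div_div_eq_mul_div, div_one]
      have : (0 : ℝ) ≤ n / l := by positivity
      have h5 : 2 * ((n : ℝ) / s + W) ≤ 16 * (n / l + k + W) := by linarith
      calc 4 * (a : ℝ) * (2 * ((n : ℝ) / s + W)) ≤ 4 * (a : ℝ) * (16 * (n / l + k + W)) := by gcongr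
        _ = _ := by ring
    refine (fail_count hw (P := params c n k l) hk ha0.ne'
      (fun a ha b hb => (hu b hb).trans_lt (huv.trans_le (hv a ha))) hs2 (min_le_left _ _) hsn
      (fun i hi => le_rate hw hv0 hv hs2 hsn (by rw [hk]; exact hs4) hi) hδ S N 0 ?_ hN ?_).trans ?_
    · simp
    · have : ∀ b : Fin n, ¬ (params c n k l).wins ≤ (0 : Fin n → ℕ) b := by
        intro b
        exact not_le.2 ha0
      rw [Finset.filter_false_of_mem fun b _ => this b, Finset.card_empty]
      exact hk1
    · have hc : ∀ T : Finset (Fin n), (T.card : ℝ≥0∞) ≤ n := fun T => by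
        exact_mod_cast (Finset.card_le_univ T).trans_eq (Fintype.card_fin n)
      have t1 : ∑ i ∈ top, ∑ j ∈ topᶜ, overtake (params c n k l).wins (0 : Fin n → ℕ) i j ≤
          (n : ℝ≥0∞) ^ 2 * 2⁻¹ ^ a := by
        simp only [overtake, Pi.zero_apply, if_true, pow_zero, one_mul, Finset.sum_const,
          nsmul_eq_mul]
        rw [sq, mul_assoc]
        exact mul_le_mul' (hc _) (mul_le_mul' (hc _) le_rfl)
      have t2 : ∑ i ∈ top, shortage (params c n k l).wins (0 : Fin n → ℕ) i *
          ENNReal.ofReal (1 - ρ / 2) ^ S ≤ (n : ℝ≥0∞) ^ 2 * 2⁻¹ ^ a := by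
        refine le_trans ?_ hsmall
        simp only [shortage, Pi.zero_apply, pow_zero, mul_one, Finset.sum_const, nsmul_eq_mul]
        exact mul_le_mul' (hc _) (two_pow_mul_pow_le hρ0 a S hd)
      -- Overtaking and shortage contribute one unit n² · 2^(−a) each, the refinement two.
      calc _ ≤ (n : ℝ≥0∞) ^ 2 * 2⁻¹ ^ a + (n : ℝ≥0∞) ^ 2 * 2⁻¹ ^ a +
            2 * ((n : ℝ≥0∞) ^ 2 * 2⁻¹ ^ a) := by gcongr
        _ = _ := by ring
  · have hnS : n ≤ S := by
      have h1 : (n : ℝ) ≤ 8 * k := by exact_mod_cast (by omega : n ≤ 8 * k)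
      have h2 : (0 : ℝ) ≤ n / l := by positivity
      have h3 : (n : ℝ) ≤ S := by nlinarith
      exact_mod_cast h3
    refine (hδ Finset.univ N (Finset.subset_univ _) (by simpa using hnS) (by omega)).trans ?_
    gcongr
    norm_num

end Main

/-- The constant factor of the bound on the number of comparisons. -/
def budgetConst (c : ℕ) : ℝ :=
  65 * 4 * (4 * (c + 4)) + 1170 * 2 ^ 14 * (4 * (c + 4)) ^ 3 +
    160 * 2 ^ 14 * (4 * (4 * (c + 4)) + 12)

theorem budgetConst_pos (c : ℕ) : 0 < budgetConst c := by unfold budgetConst; positivity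

/-- Both a and R are O(X), and lower powers of X are absorbed into X³ because X ≥ 1/2. -/
theorem budget_le {c : ℕ} {a R S B X H : ℝ} (ha : 1 ≤ a) (haX : a ≤ 4 * (c + 4) * X)
    (hX : 1 ≤ 2 * X) (hH : 1 ≤ H) (hR : R ≤ 8 * X)
    (hS : S ≤ 65 * (a * H)) (hB0 : 0 ≤ B) (hB : B ≤ 10 * 2 ^ 14 * ((4 * a + R + 2) * H)) :
    S + (3 * a * (S * (2 ^ 14 * (4 * a + 2))) + R * B) ≤ budgetConst c * X ^ 3 * H := by
  set b : ℝ := 4 * (c + 4) with hb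
  have hb0 : 0 ≤ b := by positivity
  have hX0 : 0 ≤ X := by linarith
  have hX2 : X ≤ 4 * X ^ 3 := by nlinarith [mul_nonneg hX0 (by nlinarith : 0 ≤ 4 * X ^ 2 - 1)]
  have hX3 : X ^ 2 ≤ 2 * X ^ 3 := by nlinarith [sq_nonneg X]
  have s1 : S ≤ 65 * 4 * b * X ^ 3 * H := by
    calc S ≤ 65 * (a * H) := hS
      _ ≤ 65 * (b * (4 * X ^ 3) * H) := by
          gcongr
          exact haX.trans (by gcongr)
      _ = _ := by ring
  have s2 : 3 * a * (S * (2 ^ 14 * (4 * a + 2))) ≤ 1170 * 2 ^ 14 * b ^ 3 * X ^ 3 * H := by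
    calc 3 * a * (S * (2 ^ 14 * (4 * a + 2)))
        ≤ 3 * a * (65 * (a * H) * (2 ^ 14 * (6 * a))) := by gcongr; linarith
      _ = 1170 * 2 ^ 14 * a ^ 3 * H := by ring
      _ ≤ 1170 * 2 ^ 14 * (b * X) ^ 3 * H := by gcongr
      _ = _ := by ring
  have s3 : R * B ≤ 160 * 2 ^ 14 * (4 * b + 12) * X ^ 3 * H := by
    calc R * B ≤ 8 * X * (10 * 2 ^ 14 * ((4 * (b * X) + 8 * X + 2 * (2 * X)) * H)) := by
          refine mul_le_mul hR (hB.trans ?_) hB0 (by positivity)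
          gcongr
          linarith
      _ = 80 * 2 ^ 14 * (4 * b + 12) * X ^ 2 * H := by ring
      _ ≤ 80 * 2 ^ 14 * (4 * b + 12) * (2 * X ^ 3) * H := by gcongr
      _ = _ := by ring
  have : budgetConst c * X ^ 3 * H = 65 * 4 * b * X ^ 3 * H + 1170 * 2 ^ 14 * b ^ 3 * X ^ 3 * H +
      160 * 2 ^ 14 * (4 * b + 12) * X ^ 3 * H := by
    rw [budgetConst, ← hb]; ring
  linarith

end TopK

/-! ### Transfer to ranking instances and conclusion -/

namespace RankingInstance

variable {n k : ℕ} (I : RankingInstance n k)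

theorem label_mem_topLabels (i : Fin n) : I.label i ∈ I.topLabels ↔ (i : ℕ) < k := by
  simp [topLabels]

theorem card_topLabels : I.topLabels.card = k := by
  have h := I.lt
  rw [topLabels, Finset.card_map, Fin.card_filter_val_lt]
  omega

theorem θk_le_labelScore (a : Fin n) (ha : a ∈ I.topLabels) : I.θk ≤ I.labelScore a := by
  obtain ⟨i, rfl⟩ := I.label.surjective a
  rw [label_mem_topLabels] at ha
  rw [labelScore, Equiv.symm_apply_apply]
  exact I.anti (Fin.le_def.2 (by simp only; omega))

theorem labelScore_le_θk1 (a : Fin n) (ha : a ∉ I.topLabels) : I.labelScore a ≤ I.θk1 := by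
  obtain ⟨i, rfl⟩ := I.label.surjective a
  rw [label_mem_topLabels] at ha
  rw [labelScore, Equiv.symm_apply_apply]
  exact I.anti (Fin.le_def.2 (by simp only; omega))

theorem complexity_eq (l : ℕ) : I.complexity l =
    (n : ℝ) / l + k + (∑ a ∈ I.topLabelsᶜ, I.labelScore a) / I.θk
      + ∑ a ∈ I.topLabelsᶜ.filter (fun a => I.θk / 2 ≤ I.labelScore a),
          I.θk ^ 2 / (I.θk - I.labelScore a) ^ 2
      + ∑ a ∈ I.topLabels.filter (fun a => I.labelScore a ≤ 2 * I.θk1),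
          I.θk1 ^ 2 / (I.θk1 - I.labelScore a) ^ 2 := by
  unfold complexity
  congr 1
  · congr 1
    · congr 2
      refine Finset.sum_equiv I.label (fun i => ?_) fun i _ => ?_
      · simp [label_mem_topLabels]
      · simp [labelScore]
    · refine Finset.sum_equiv I.label (fun i => ?_) fun i _ => ?_
      · rw [Finset.mem_filter, Finset.mem_filter, Finset.mem_compl, label_mem_topLabels,
          labelScore, Equiv.symm_apply_apply]
        simp
      · simp [labelScore]
  · refine Finset.sum_equiv I.label (fun i => ?_) fun i _ => ?_
    · rw [Finset.mem_filter, Finset.mem_filter, label_mem_topLabels, labelScore,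
        Equiv.symm_apply_apply]
      simp
    · simp [labelScore]

theorem fail_le (c : ℕ) {l : ℕ} (hl : 2 ≤ l) :
    (TopK.algorithm n k l (TopK.params c n k l)).fail I.labelScore I.labelScore_pos I.topLabels
      ⌊TopK.budgetConst c * Real.log (n * (I.θk / (I.θk - I.θk1))) ^ 3 * I.complexity l⌋₊
      (TopK.algorithm n k l (TopK.params c n k l)).start ≤ ((n : ℝ≥0∞) ^ c)⁻¹ := by
  set u := I.θk1 with hu
  set v := I.θk with hv
  have hu0 : 0 < u := I.pos _
  have huv : u < v := I.gap
  have hv0 : 0 < v := hu0.trans huv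
  have hn : 2 ≤ n := by have := I.one_le; have := I.lt; omega
  have hn0 : (0 : ℝ) < n := by positivity
  have hk1 := I.one_le
  set x := v / (v - u) with hx
  have hvu : 0 < v - u := by linarith
  have hx1 : 1 ≤ x := by rw [hx, one_le_div hvu]; linarith
  set X := Real.log (n * x) with hX
  have hXe : X = Real.log n + Real.log x := Real.log_mul (by positivity) (by positivity)
  have hlx : 0 ≤ Real.log x := Real.log_nonneg hx1
  have hln : Real.log 2 ≤ Real.log n := Real.log_le_log (by norm_num) (by exact_mod_cast hn)
  have hl2 : (1 : ℝ) / 2 < Real.log 2 := by linarith [Real.log_two_gt_d9]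
  obtain ⟨R, hR, hRX⟩ := TopK.exists_pow_gap hx1
  rw [hx, inv_div] at hR
  set a : ℕ := (c + 4) * Nat.clog 2 n with ha
  have ha0 : 0 < a := Nat.mul_pos (by omega) (Nat.clog_pos (by norm_num) hn)
  have haX : (a : ℝ) ≤ 4 * (c + 4) * X := by
    have h1 := TopK.natCast_clog_le hn
    rw [ha]
    push_cast
    calc ((c : ℝ) + 4) * Nat.clog 2 n ≤ (c + 4) * (4 * X) := by gcongr; linarith
      _ = _ := by ring
  set H1 := (n : ℝ) / l + k + (∑ a ∈ I.topLabelsᶜ, I.labelScore a) / v with hH1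
  set H2 := ∑ a ∈ I.topLabelsᶜ.filter (fun a => v / 2 ≤ I.labelScore a),
      v ^ 2 / (v - I.labelScore a) ^ 2 +
    ∑ a ∈ I.topLabels.filter (fun a => I.labelScore a ≤ 2 * u),
      u ^ 2 / (u - I.labelScore a) ^ 2 with hH2
  have hH : I.complexity l = H1 + H2 := by rw [I.complexity_eq l, hH1, hH2, add_assoc]
  have hH20 : 0 ≤ H2 := by positivity
  have hH11 : 1 ≤ H1 := by
    have h1 : (1 : ℝ) ≤ k := by exact_mod_cast hk1
    have h2 : 0 ≤ (∑ a ∈ I.topLabelsᶜ, I.labelScore a) / v :=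
      div_nonneg (Finset.sum_nonneg fun a _ => (I.labelScore_pos a).le) hv0.le
    have h3 : (0 : ℝ) ≤ n / l := by positivity
    linarith
  have ha1 : (1 : ℝ) ≤ a := by exact_mod_cast ha0
  have hSreal : 0 ≤ 64 * (a : ℝ) * H1 := by positivity
  have hBreal : 0 ≤ 2 ^ 14 * ((4 * a + R + 2 : ℕ) : ℝ) * (9 * H2) := by positivity
  -- Rounding up adds at most 1, which turns the constants 64 and 9 into the 65 and 10 of
  -- `budget_le`.
  obtain ⟨S, hS1, hS2⟩ : ∃ S : ℕ, 64 * (a : ℝ) * H1 ≤ S ∧ (S : ℝ) ≤ 64 * (a : ℝ) * H1 + 1 :=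
    ⟨_, Nat.le_ceil _, (Nat.ceil_lt_add_one hSreal).le⟩
  obtain ⟨B, hB1, hB2⟩ : ∃ B : ℕ, 2 ^ 14 * ((4 * a + R + 2 : ℕ) : ℝ) * (9 * H2) ≤ B ∧
      (B : ℝ) ≤ 2 ^ 14 * ((4 * a + R + 2 : ℕ) : ℝ) * (9 * H2) + 1 :=
    ⟨_, Nat.le_ceil _, (Nat.ceil_lt_add_one hBreal).le⟩
  refine TopK.fail_start_le I.labelScore_pos hn hk1 hl I.card_topLabels I.labelScore_le_θk1 huv hu0
    I.θk_le_labelScore hR hB1 hS1 (Nat.le_floor ?_)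
  rw [hH]
  have key := TopK.budget_le (c := c) (a := a) (R := R) (S := S) (B := B) (X := X) (H := H1 + H2)
    ha1 haX (by linarith) (by linarith) (by linarith) (by
      refine hS2.trans ?_
      have : 1 ≤ (a : ℝ) * H1 := one_le_mul_of_one_le_of_one_le ha1 hH11
      nlinarith) (Nat.cast_nonneg _) (by
      refine hB2.trans ?_
      push_cast
      have h1 : (0 : ℝ) ≤ R := Nat.cast_nonneg _
      have h2 : 1 ≤ (4 * (a : ℝ) + R + 2) * (H1 + H2) :=
        one_le_mul_of_one_le_of_one_le (by linarith) (by linarith)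
      have h3 : (4 * (a : ℝ) + R + 2) * H2 ≤ (4 * (a : ℝ) + R + 2) * (H1 + H2) := by
        gcongr; linarith
      linarith)
  refine le_of_eq_of_le ?_ key
  push_cast [ha]
  ring

end RankingInstance

end

theorem theorem1 :
    ∃ p : ℕ, ∀ c : ℕ, ∃ C : ℝ, 0 < C ∧
      ∃ A : (n k l : ℕ) → ActiveAlgorithm n l,
        ∀ (n k l : ℕ), 2 ≤ l → ∀ I : RankingInstance n k,
          1 - 1 / (n : ℝ) ^ c ≤
            ((A n k l).run I.labelScore I.labelScore_pos
              ⌊C * Real.log (n * (I.θk / (I.θk - I.θk1))) ^ p * I.complexity l⌋₊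
              (some I.topLabels)).toReal := by
  -- In the coarse phase the number of rounds, the candidate bound S and the samples per pair carry
  -- one logarithm each.
  refine ⟨3, fun c => ⟨TopK.budgetConst c, TopK.budgetConst_pos c,
    fun n k l => (TopK.algorithm n k l (TopK.params c n k l)).toActive, fun n k l hl I => ?_⟩⟩
  have hn : n ≠ 0 := by have := I.lt; omega
  have h := I.fail_le c hl
  rw [RoundAlgorithm.run_apply, ENNReal.toReal_sub_of_le (RoundAlgorithm.fail_le_one _ _ _ _ _ _)
    ENNReal.one_ne_top, ENNReal.toReal_one]
  have h2 := ENNReal.toReal_mono (by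
    rw [Ne, ENNReal.inv_eq_top]
    exact pow_ne_zero _ (by exact_mod_cast hn)) h
  rw [ENNReal.toReal_inv, ENNReal.toReal_pow, ENNReal.toReal_natCast, ← one_div] at h2
  linarith
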